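/- For $n\in\mathbb N$ let $B_2^n$ be the closed Euclidean unit ball of $\mathbb R^n$, let $\operatorname{vol}_{n-1}$ be $(n-1)$-dimensional surface measure (normalized Hausdorff measure), and for convex bodies $K,L\subset\mathbb R^n$ let $$\Delta_s(K,L)=\operatorname{vol}_{n-1}\bigl(\partial(K\cup L)\bigr)-\operatorname{vol}_{n-1}\bigl(\partial(K\cap L)\bigr)$$ be their symmetric surface area deviation. A polytope in $\mathbb R^n$ (the convex hull of a nonempty finite set) is called simple if at every vertex exactly $n$ facets, i.e. $(n-1)$-dimensional faces, meet. There are an absolute constant $c>0$ and an $N_0\in\mathbb N$ such that for all integers $n\ge 2$, all integers $N\ge N_0$ and all simple polytopes $P_N$ in $\mathbb R^n$ with at most $N$ vertices, $$\Delta_s(B_2^n,P_N)\;\ge\; c\,\frac{\operatorname{vol}_{n-1}(\partial B_2^n)}{N^{\frac{2}{n-1}}}.$$ -/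

import Mathlib

open MeasureTheory

/-- Surface area: the `(n-1)`-dimensional volume of the boundary of a set in `ℝⁿ`, measured by the
Hausdorff measure normalised to agree with Lebesgue measure on `(n-1)`-dimensional subspaces. -/
noncomputable def surfaceArea {n : ℕ} (K : Set (EuclideanSpace ℝ (Fin n))) : ℝ :=
  (Measure.euclideanHausdorffMeasure (n - 1)).real (frontier K)

/-- The symmetric surface area deviation of `K` and `L`. -/
noncomputable def surfaceDeviation {n : ℕ} (K L : Set (EuclideanSpace ℝ (Fin n))) : ℝ :=
  surfaceArea (K ∪ L) - surfaceArea (K ∩ L)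

/-- The closed Euclidean unit ball of `ℝⁿ`. -/
def unitBall (n : ℕ) : Set (EuclideanSpace ℝ (Fin n)) :=
  Metric.closedBall 0 1

/-- A polytope is the convex hull of a nonempty finite set of points. -/
def IsPolytope {n : ℕ} (P : Set (EuclideanSpace ℝ (Fin n))) : Prop :=
  ∃ S : Set (EuclideanSpace ℝ (Fin n)), S.Finite ∧ S.Nonempty ∧ P = convexHull ℝ S

/-- The vertices of a polytope are its extreme points. -/
def vertices {n : ℕ} (P : Set (EuclideanSpace ℝ (Fin n))) : Set (EuclideanSpace ℝ (Fin n)) :=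
  P.extremePoints ℝ

/-- A facet of `P ⊆ ℝⁿ` is an `(n-1)`-dimensional face, a face being the nonempty set of points of
`P` at which some linear functional attains its maximum over `P`. -/
def IsFacet {n : ℕ} (P F : Set (EuclideanSpace ℝ (Fin n))) : Prop :=
  F.Nonempty ∧ IsExposed ℝ P F ∧ Module.finrank ℝ (vectorSpan ℝ F) + 1 = n

/-- A polytope in `ℝⁿ` is simple if at every vertex exactly `n` facets meet. For `n ≥ 2` this forces
`P` to be `n`-dimensional, since a lower-dimensional polytope has at most one face of dimension
`n - 1`, namely itself. -/
def IsSimplePolytope {n : ℕ} (P : Set (EuclideanSpace ℝ (Fin n))) : Prop :=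
  IsPolytope P ∧ ∀ v ∈ vertices P, {F | IsFacet P F ∧ v ∈ F}.encard = n

open Set Metric Module Measure Filter Topology
open scoped Pointwise ENNReal NNReal RealInnerProductSpace

/-! ### Contracting projections and volumes of cones. -/

section

variable {E : Type*} [NormedAddCommGroup E] [InnerProductSpace ℝ E]

/-! Only the number of facets matters. In a simple polytope each vertex lies on `n` facets and each
facet contains at least `n` vertices, so counting incidences gives at most `N` facets
(`IsSimplePolytope.ncard_facets_le`).

Write `B` for the ball, `S` for the sphere, `H` for surface measure. Up to null sets the deviation
is the sum of an inner gain `H(S \ P) - H(∂P ∩ B)` and an outer gain `H(∂P \ B) - H(S ∩ P)`. Inside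
the ball, each facet is lifted along its outer normal to `S`; the lifts are disjoint and miss `P`,
and the inverse of a lift is an orthogonal projection, which contracts area
(`HasFaces.frontier_inter_ball_le`). Outside, radial projection maps `∂P \ B` onto `S ∩ P` and
contracts area too (`HasFaces.sphere_inter_le`). So both gains are nonnegative.

The contraction is strict at directions away from the normals. If `⟪y, u⟫ ≤ k ^ 2` for all `y ∈ G ⊆
S` and all facet normals `u`, projection onto facets gains a factor `k ^ 2` over `G` and radial
projection a factor `k`, so the deviation is at least `(1 - k) H(G)`
(`HasFaces.mul_sphere_inter_le_deviation`). Caps of radius `ε` of order `N ^ (-1 / (n - 1))` about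
the at most `N` normals cover at most half of `S`. Off these caps `k ^ 2 = 1 - ε ^ 2 / 2` works, and
`1 - k ≥ ε ^ 2 / 4` has the required order.

The area comparisons on the sphere come from volumes of cones and shells, hence concern the
polar-coordinate measure `sphereMeasure`; `sphereMeasure_eq_restrict` identifies it with Hausdorff
measure. -/

theorem LipschitzOnWith.euclideanHausdorffMeasure_image_le {X Y : Type*}
    [MetricSpace X] [MeasurableSpace X] [BorelSpace X]
    [MetricSpace Y] [MeasurableSpace Y] [BorelSpace Y] {f : X → Y} {s : Set X}
    (hf : LipschitzOnWith 1 f s) (d : ℕ) : μHE[d] (f '' s) ≤ μHE[d] s := by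
  simp_rw [euclideanHausdorffMeasure_def, Measure.smul_apply]
  gcongr
  simpa using hf.hausdorffMeasure_image_le (d := d) (by positivity)

/-- The radial projection onto the unit sphere does not increase distances outside the open unit
ball. -/
theorem dist_inv_norm_smul_le {x y : E} (hx : 1 ≤ ‖x‖) (hy : 1 ≤ ‖y‖) :
    dist (‖x‖⁻¹ • x) (‖y‖⁻¹ • y) ≤ dist x y := by
  have hx0 : 0 < ‖x‖ := by linarith
  have hy0 : 0 < ‖y‖ := by linarith
  rw [dist_eq_norm, dist_eq_norm]
  refine le_of_sq_le_sq ?_ (norm_nonneg _)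
  rw [norm_sub_sq_real, norm_sub_sq_real, norm_smul, norm_smul, real_inner_smul_left,
    real_inner_smul_right, norm_inv, norm_inv, norm_norm, norm_norm, inv_mul_cancel₀ hx0.ne',
    inv_mul_cancel₀ hy0.ne']
  have hi : ⟪x, y⟫ ≤ ‖x‖ * ‖y‖ := real_inner_le_norm x y
  set a := ‖x‖
  set b := ‖y‖
  set i := a⁻¹ * (b⁻¹ * ⟪x, y⟫) with hi_def
  have h1 : ⟪x, y⟫ = a * b * i := by rw [hi_def]; field_simp
  have hab : 1 ≤ a * b := by nlinarith
  have h2 : i ≤ 1 := by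
    rw [h1] at hi
    by_contra! h
    nlinarith
  rw [h1]
  -- With `i` the cosine of the angle, the difference of the squared distances is `(a - b) ^ 2 + 2 *
  -- (a * b - 1) * (1 - i)`.
  nlinarith [sq_nonneg (a - b), mul_nonneg (sub_nonneg.2 hab) (sub_nonneg.2 h2)]

theorem lipschitzOnWith_inv_norm_smul :
    LipschitzOnWith 1 (fun x : E => ‖x‖⁻¹ • x) {x | 1 ≤ ‖x‖} :=
  LipschitzOnWith.of_dist_le_mul fun x hx y hy => by
    simpa using dist_inv_norm_smul_le hx hy

variable [MeasurableSpace E] [BorelSpace E]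

/-- A flat set is not larger than any set from which it can be reached by moving along the normal
direction. -/
theorem euclideanHausdorffMeasure_le_of_lift {u : E} (hu : ‖u‖ = 1) {h : ℝ} {X A : Set E}
    (hX : ∀ x ∈ X, ⟪x, u⟫ = h) (hXA : ∀ x ∈ X, ∃ s : ℝ, x + s • u ∈ A) (d : ℕ) :
    μHE[d] X ≤ μHE[d] A := by
  have huu : ⟪u, u⟫ = 1 := by simp [hu]
  -- This map is the orthogonal projection onto the hyperplane at height `h`; it undoes the lift and
  -- contracts distances.
  have hL : LipschitzOnWith 1 (fun y : E => y - (⟪y, u⟫ - h) • u) A := by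
    refine LipschitzOnWith.of_dist_le_mul fun x _ y _ => ?_
    rw [NNReal.coe_one, one_mul, dist_eq_norm, dist_eq_norm]
    have : x - (⟪x, u⟫ - h) • u - (y - (⟪y, u⟫ - h) • u) = (x - y) - ⟪x - y, u⟫ • u := by
      rw [inner_sub_left]; module
    rw [this]
    refine le_of_sq_le_sq ?_ (norm_nonneg _)
    rw [norm_sub_sq_real, norm_smul, hu, real_inner_smul_right, mul_one, Real.norm_eq_abs, sq_abs]
    nlinarith [sq_nonneg ⟪x - y, u⟫]
  refine le_trans (measure_mono ?_) (hL.euclideanHausdorffMeasure_image_le d)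
  intro x hx
  obtain ⟨s, hs⟩ := hXA x hx
  refine ⟨_, hs, ?_⟩
  simp only [inner_add_left, real_inner_smul_left, huu, hX x hx]
  module

variable [FiniteDimensional ℝ E]

/-- The rotation invariant surface measure of the unit sphere, as a measure on the ambient space. -/
noncomputable def sphereMeasure (E : Type*) [NormedAddCommGroup E] [InnerProductSpace ℝ E]
    [MeasurableSpace E] [BorelSpace E] [FiniteDimensional ℝ E] : Measure E :=
  (volume : Measure E).toSphere.map (↑)

instance : IsFiniteMeasure (sphereMeasure E) := by
  unfold sphereMeasure; infer_instance

theorem sphereMeasure_apply {A : Set E} (hA : MeasurableSet A) :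
    sphereMeasure E A = finrank ℝ E * volume (Ioo (0 : ℝ) 1 • (A ∩ sphere 0 1)) := by
  rw [sphereMeasure, map_apply measurable_subtype_coe hA,
    toSphere_apply' _ (hA.preimage measurable_subtype_coe), Subtype.image_preimage_coe, inter_comm]

theorem sphereMeasure_inter_sphere (A : Set E) :
    sphereMeasure E (A ∩ sphere 0 1) = sphereMeasure E A := by
  refine measure_inter_conull' ?_
  refine measure_mono_null (t := (sphere 0 1)ᶜ) (fun x hx => hx.2) ?_
  rw [sphereMeasure, map_apply measurable_subtype_coe isClosed_sphere.measurableSet.compl]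
  simp

omit [MeasurableSpace E] [BorelSpace E] [FiniteDimensional ℝ E] in
theorem Ioo_smul_eq_smul_Ioo_smul {r : ℝ} (hr : 0 < r) (D : Set E) :
    Ioo (0 : ℝ) r • D = r • (Ioo (0 : ℝ) 1 • D) := by
  ext x
  constructor
  · rintro ⟨t, ht, y, hy, rfl⟩
    refine ⟨(t / r) • y, ⟨t / r, ⟨by have := ht.1; positivity, (div_lt_one hr).2 ht.2⟩, y, hy, rfl⟩, ?_⟩
    simp only [smul_smul]
    congr 1
    field_simp
  · rintro ⟨_, ⟨t, ht, y, hy, rfl⟩, rfl⟩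
    exact ⟨r * t, ⟨mul_pos hr ht.1, by nlinarith [ht.2]⟩, y, hy, by simp [smul_smul]⟩

theorem volume_Ioo_smul {r : ℝ} (hr : 0 < r) (D : Set E) :
    volume (Ioo (0 : ℝ) r • D) =
      ENNReal.ofReal (r ^ finrank ℝ E) * volume (Ioo (0 : ℝ) 1 • D) := by
  rw [Ioo_smul_eq_smul_Ioo_smul hr, addHaar_smul, abs_of_pos (by positivity)]

/-- Volume of a cone. -/
theorem finrank_mul_volume_cone {u : E} (hu : ‖u‖ = 1) {h : ℝ} (hh : 0 < h) {X : Set E}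
    (hX : ∀ x ∈ X, ⟪x, u⟫ = h) (hXm : MeasurableSet X) :
    finrank ℝ E * volume (Ioo (0 : ℝ) 1 • X) =
      ENNReal.ofReal h * μHE[finrank ℝ E - 1] X := by
  have hu0 : u ≠ 0 := by rintro rfl; simp at hu
  have hd : 0 < finrank ℝ E := finrank_pos_iff_exists_ne_zero.2 ⟨u, hu0⟩
  obtain ⟨d, hd⟩ : ∃ d, finrank ℝ E = d + 1 := ⟨finrank ℝ E - 1, by omega⟩
  -- Describing the cone by height and central projection shows that it is measurable.
  have hC : Ioo (0 : ℝ) 1 • X =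
      {x | 0 < ⟪x, u⟫ ∧ ⟪x, u⟫ < h} ∩ (fun x : E => (h / ⟪x, u⟫) • x) ⁻¹' X := by
    ext x
    constructor
    · rintro ⟨t, ht, y, hy, rfl⟩
      have := ht.1
      refine ⟨?_, ?_⟩
      · simp only [mem_ofPred_eq, real_inner_smul_left, hX y hy]
        exact ⟨by positivity, by nlinarith [ht.2]⟩
      · simp only [mem_preimage, real_inner_smul_left, hX y hy, smul_smul]
        rwa [show h / (t * h) * t = 1 by field_simp, one_smul]
    · rintro ⟨⟨h1, h2⟩, h3⟩
      refine ⟨⟪x, u⟫ / h, ⟨by positivity, (div_lt_one hh).2 h2⟩, _, h3, ?_⟩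
      simp only [smul_smul]
      rw [show ⟪x, u⟫ / h * (h / ⟪x, u⟫) = 1 by field_simp, one_smul]
  have hCm : MeasurableSet (Ioo (0 : ℝ) 1 • X) := by
    rw [hC]
    have hm : Measurable fun x : E => ⟪x, u⟫ := by fun_prop
    exact ((measurableSet_lt measurable_const hm).inter (measurableSet_lt hm measurable_const)).inter
      (hXm.preimage ((measurable_const.div hm).smul measurable_id))
  -- The slice at height `t` is the homothetic copy `(t / h) • X`, so by Fubini the volume is the
  -- integral of `(t / h) ^ d` times the measure of `X`.
  have hslice : ∀ t : ℝ, μHE[finrank ℝ E - 1]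
      (Ioo (0 : ℝ) 1 • X ∩ (AffineSubspace.mk' (t • u +ᵥ (0 : E)) (ℝ ∙ u)ᗮ : Set E)) =
      (Ioo 0 h).indicator (fun t => ENNReal.ofReal ((t / h) ^ d) * μHE[finrank ℝ E - 1] X) t := by
    intro t
    have hmem : ∀ x : E, x ∈ (AffineSubspace.mk' (t • u +ᵥ (0 : E)) (ℝ ∙ u)ᗮ : Set E) ↔
        ⟪x, u⟫ = t := by
      intro x
      rw [SetLike.mem_coe, AffineSubspace.mem_mk', Submodule.mem_orthogonal_singleton_iff_inner_left]
      simp [inner_sub_left, real_inner_smul_left, hu, sub_eq_zero]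
    by_cases ht : t ∈ Ioo 0 h
    · rw [indicator_of_mem ht]
      have htp := ht.1
      have : Ioo (0 : ℝ) 1 • X ∩ (AffineSubspace.mk' (t • u +ᵥ (0 : E)) (ℝ ∙ u)ᗮ : Set E) =
          (t / h) • X := by
        ext x
        rw [mem_inter_iff, hmem]
        constructor
        · rintro ⟨⟨s, hs, y, hy, rfl⟩, h2⟩
          simp only [real_inner_smul_left, hX y hy] at h2
          refine ⟨y, hy, ?_⟩
          simp only [← h2]
          congr 1
          field_simp
        · rintro ⟨y, hy, rfl⟩
          refine ⟨⟨t / h, ⟨by positivity, (div_lt_one hh).2 ht.2⟩, y, hy, rfl⟩, ?_⟩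
          simp only [real_inner_smul_left, hX y hy]
          field_simp
      rw [this, euclideanHausdorffMeasure_smul₀ _ (by positivity : t / h ≠ 0), hd]
      simp only [Nat.add_sub_cancel, ENNReal.smul_def, smul_eq_mul]
      congr 1
      rw [ENNReal.ofReal_pow (by positivity), ← Real.enorm_eq_ofReal (by positivity), ENNReal.coe_pow]
      rfl
    · rw [indicator_of_notMem ht]
      convert measure_empty (μ := μHE[finrank ℝ E - 1])
      rw [eq_empty_iff_forall_notMem]
      rintro x ⟨⟨s, hs, y, hy, rfl⟩, h2⟩
      rw [hmem] at h2
      simp only [real_inner_smul_left, hX y hy] at h2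
      exact ht ⟨by rw [← h2]; exact mul_pos hs.1 hh, by rw [← h2]; nlinarith [hs.2]⟩
  rw [← InnerProductSpace.euclideanHausdorffMeasure_eq_volume,
    EuclideanGeometry.euclideanHausdorffMeasure_eq_lintegral (0 : E) hu0 hCm]
  have hint : ∫⁻ t in Ioo 0 h, ENNReal.ofReal ((t / h) ^ d) = ENNReal.ofReal (h / (d + 1)) := by
    rw [restrict_congr_set Ioo_ae_eq_Ioc, ← ofReal_integral_eq_lintegral_ofReal]
    · rw [← intervalIntegral.integral_of_le hh.le]
      congr 1
      simp_rw [div_pow]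
      rw [intervalIntegral.integral_div, integral_pow]
      field_simp
      simp [pow_succ]
    · exact (Continuous.integrableOn_Icc (by fun_prop)).mono_set Ioc_subset_Icc_self
    · filter_upwards [ae_restrict_mem measurableSet_Ioc] with t ht
      have := ht.1.le
      positivity
  simp_rw [hslice]
  rw [lintegral_indicator measurableSet_Ioo, lintegral_mul_const _ (by fun_prop), hint,
    ← ofReal_norm, hu, ENNReal.ofReal_one, one_mul, ← mul_assoc]
  congr 1
  rw [hd, ← ENNReal.ofReal_natCast, ← ENNReal.ofReal_mul (by positivity)]
  congr 1
  push_cast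
  field_simp

/-- Comparison of a flat set with a set of directions in which it is seen from the origin. -/
theorem pow_mul_sphereMeasure_le {u : E} (hu : ‖u‖ = 1) {h : ℝ} (hh : 0 < h) {X : Set E}
    (hX : ∀ x ∈ X, ⟪x, u⟫ = h) (hXm : MeasurableSet X) {D : Set E} (hD : MeasurableSet D)
    {r : ℝ} (hr : 0 < r) (hDX : ∀ θ ∈ D, ∃ t : ℝ, r ≤ t ∧ t • θ ∈ X) :
    ENNReal.ofReal (r ^ finrank ℝ E) * sphereMeasure E D ≤
      ENNReal.ofReal h * μHE[finrank ℝ E - 1] X := by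
  rw [← finrank_mul_volume_cone hu hh hX hXm, sphereMeasure_apply hD, mul_left_comm,
    ← volume_Ioo_smul hr]
  refine mul_le_mul_right (measure_mono ?_) _
  -- Since `X` is met at distance at least `r` in every direction of `D`, the cone over `X` contains
  -- the sector of radius `r` over `D`.
  rintro _ ⟨s, hs, θ, hθ, rfl⟩
  obtain ⟨t, ht, htX⟩ := hDX θ hθ.1
  have ht0 : 0 < t := by linarith
  refine ⟨s / t, ⟨div_pos hs.1 ht0, (div_lt_one ht0).2 (hs.2.trans_le ht)⟩, _, htX, ?_⟩
  simp only [smul_smul]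
  rw [div_mul_cancel₀ _ ht0.ne']

end

/-! ### Gain of the orthogonal projection where the sphere is inclined. -/

section

variable {E : Type*} [NormedAddCommGroup E] [InnerProductSpace ℝ E]
variable [MeasurableSpace E] [BorelSpace E] [FiniteDimensional ℝ E]

/-- Volume of a set containing a vertical segment of length `τ` over each point of a flat set. -/
theorem mul_euclideanHausdorffMeasure_le_volume {u : E} (hu : ‖u‖ = 1) {h : ℝ} {X : Set E}
    (hX : ∀ x ∈ X, ⟪x, u⟫ = h) (hXm : MeasurableSet X) {Ω : Set E} (hΩ : MeasurableSet Ω)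
    {τ : ℝ} (hXΩ : ∀ x ∈ X, ∃ s₀ : ℝ, ∀ s ∈ Icc 0 τ, x + (s₀ + s) • u ∈ Ω) :
    ENNReal.ofReal τ * μHE[finrank ℝ E - 1] X ≤ volume Ω := by
  have hu0 : u ≠ 0 := by rintro rfl; simp at hu
  let p : AffineSubspace ℝ E := AffineSubspace.mk' (h • u) (ℝ ∙ u)ᗮ
  have hp : ∀ x, x ∈ p ↔ ⟪x, u⟫ = h := by
    intro x
    rw [AffineSubspace.mem_mk', Submodule.mem_orthogonal_singleton_iff_inner_left]
    simp [inner_sub_left, real_inner_smul_left, hu, sub_eq_zero]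
  have hdir : p.direction = (ℝ ∙ u)ᗮ := AffineSubspace.direction_mk' _ _
  have hdir' : p.directionᗮ = ℝ ∙ u := by rw [hdir, Submodule.orthogonal_orthogonal]
  have hr1 : finrank ℝ p.directionᗮ = 1 := by rw [hdir', finrank_span_singleton hu0]
  have hr2 : finrank ℝ p.direction = finrank ℝ E - 1 := by
    have := p.direction.finrank_add_finrank_orthogonal
    omega
  have : Nonempty p := ⟨⟨h • u, AffineSubspace.self_mem_mk' _ _⟩⟩
  have hXp : X = (Subtype.val : p → E) '' (Subtype.val ⁻¹' X) :=
    (image_preimage_eq_of_subset fun x hx => ⟨⟨x, (hp x).2 (hX x hx)⟩, rfl⟩).symm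
  rw [← InnerProductSpace.euclideanHausdorffMeasure_eq_volume,
    p.euclideanHausdorffMeasure_eq_lintegral hΩ, hr1, hr2]
  conv_lhs => rw [hXp, p.euclideanHausdorffMeasure_coe_image,
    ← lintegral_indicator_const (hXm.preimage measurable_subtype_coe)]
  refine lintegral_mono fun x => ?_
  by_cases hx : x ∈ (Subtype.val ⁻¹' X : Set p)
  · rw [indicator_of_mem hx]
    obtain ⟨s₀, hs₀⟩ := hXΩ x hx
    have hiso : Isometry fun s : ℝ => (x : E) + (s₀ + s) • u := by
      refine Isometry.of_dist_eq fun a b => ?_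
      rw [dist_eq_norm, dist_eq_norm, show (x : E) + (s₀ + a) • u - (x + (s₀ + b) • u) =
        (a - b) • u by module, norm_smul, hu, mul_one]
    have h1 : μHE[1] ((fun s : ℝ => (x : E) + (s₀ + s) • u) '' Icc 0 τ) = ENNReal.ofReal τ := by
      rw [hiso.euclideanHausdorffMeasure_image]
      have := InnerProductSpace.euclideanHausdorffMeasure_eq_volume (V := ℝ)
      rw [finrank_self] at this
      rw [this]
      simp
    rw [← h1]
    refine measure_mono ?_
    rintro _ ⟨s, hs, rfl⟩
    refine ⟨hs₀ s hs, ?_⟩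
    rw [SetLike.mem_coe, AffineSubspace.mem_mk', hdir']
    simp only [vsub_eq_sub, add_sub_cancel_left]
    exact Submodule.smul_mem _ _ (Submodule.mem_span_singleton_self u)
  · rw [indicator_of_notMem hx]
    exact zero_le

/-- Volume of a spherical shell over a set of directions. -/
theorem finrank_mul_volume_shell_add_le {R : ℝ} (hR : 1 ≤ R) {B : Set E} (hB : MeasurableSet B) :
    finrank ℝ E * volume {x : E | 1 ≤ ‖x‖ ∧ ‖x‖ < R ∧ ‖x‖⁻¹ • x ∈ B} + sphereMeasure E B ≤
      ENNReal.ofReal (R ^ finrank ℝ E) * sphereMeasure E B := by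
  have hR0 : 0 < R := by linarith
  have hm : MeasurableSet {x : E | 1 ≤ ‖x‖ ∧ ‖x‖ < R ∧ ‖x‖⁻¹ • x ∈ B} := by
    have h1 : Measurable fun x : E => ‖x‖ := by fun_prop
    exact (measurableSet_le measurable_const h1).inter ((measurableSet_lt h1 measurable_const).inter
      (hB.preimage (h1.inv.smul measurable_id)))
  rw [sphereMeasure_apply hB, mul_left_comm, ← volume_Ioo_smul hR0, ← mul_add,
    ← measure_union' _ hm]
  · refine mul_le_mul_right (measure_mono ?_) _
    rintro x (⟨h1, h2, h3⟩ | ⟨t, ht, y, hy, rfl⟩)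
    · have hx : 0 < ‖x‖ := by linarith
      refine ⟨‖x‖, ⟨hx, h2⟩, _, ⟨h3, ?_⟩, ?_⟩
      · rw [mem_sphere_zero_iff_norm, norm_smul, norm_inv, norm_norm, inv_mul_cancel₀ hx.ne']
      · simp only [smul_smul]
        rw [mul_inv_cancel₀ hx.ne', one_smul]
    · exact ⟨t, ⟨ht.1, ht.2.trans_le hR⟩, y, hy, rfl⟩
  · rw [Set.disjoint_left]
    rintro _ ⟨h1, -⟩ ⟨t, ht, y, hy, rfl⟩
    simp only [norm_smul, mem_sphere_zero_iff_norm.1 hy.2, mul_one, Real.norm_eq_abs,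
      abs_of_pos ht.1] at h1
    linarith [ht.2]

/-- Comparison of a flat set with a compact part of the sphere lying above it, near which the
sphere is inclined with respect to the hyperplane. -/
theorem euclideanHausdorffMeasure_le_mul_sphereMeasure {u : E} (hu : ‖u‖ = 1) {h c : ℝ}
    (hc : 0 ≤ c) {X : Set E} (hX : ∀ x ∈ X, ⟪x, u⟫ = h) (hXm : MeasurableSet X) {A : Set E}
    (hA : IsCompact A) (hAS : A ⊆ sphere 0 1) (hA0 : ∀ y ∈ A, 0 ≤ ⟪y, u⟫)
    (hAc : ∀ y ∈ A, ⟪y, u⟫ ≤ c) (hXA : ∀ x ∈ X, ∃ s : ℝ, x + s • u ∈ A) :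
    μHE[finrank ℝ E - 1] X ≤ ENNReal.ofReal c * sphereMeasure E A := by
  have hu0 : u ≠ 0 := by rintro rfl; simp at hu
  have hd : 0 < finrank ℝ E := finrank_pos_iff_exists_ne_zero.2 ⟨u, hu0⟩
  set d := finrank ℝ E with hd_def
  -- Put a segment of length `τ` in direction `u` on top of each lifted point `y`. As `‖y + s • u‖ ^
  -- 2 = 1 + 2 * s * ⟪y, u⟫ + s ^ 2`, it stays in the shell of outer radius `1 + c * τ + τ ^ 2`; the
  -- term `τ ^ 2` keeps the bound strict even for `c = 0`. Its directions lie in the `τ`-thickening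
  -- of `A`.
  have key : ∀ τ : ℝ, 0 < τ →
      d * (ENNReal.ofReal τ * μHE[d - 1] X) + sphereMeasure E (cthickening τ A) ≤
        ENNReal.ofReal ((1 + c * τ + τ ^ 2) ^ d) * sphereMeasure E (cthickening τ A) := by
    intro τ hτ
    have hR : 1 ≤ 1 + c * τ + τ ^ 2 := by nlinarith [mul_nonneg hc hτ.le]
    refine le_trans ?_ (finrank_mul_volume_shell_add_le hR isClosed_cthickening.measurableSet)
    refine add_le_add_left (mul_le_mul_right ?_ _) _
    refine mul_euclideanHausdorffMeasure_le_volume hu hX hXm ?_ ?_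
    · have h1 : Measurable fun x : E => ‖x‖ := by fun_prop
      exact (measurableSet_le measurable_const h1).inter
        ((measurableSet_lt h1 measurable_const).inter
        (isClosed_cthickening.measurableSet.preimage (h1.inv.smul measurable_id)))
    · intro x hx
      obtain ⟨s₀, hs₀⟩ := hXA x hx
      refine ⟨s₀, fun s hs => ?_⟩
      set y := x + s₀ • u with hy
      have hy1 : ‖y‖ = 1 := mem_sphere_zero_iff_norm.1 (hAS hs₀)
      have hsq : ‖y + s • u‖ ^ 2 = 1 + 2 * (s * ⟪y, u⟫) + s ^ 2 := by
        rw [norm_add_sq_real, hy1, norm_smul, hu, real_inner_smul_right, mul_one,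
          Real.norm_eq_abs, sq_abs, one_pow]
      rw [add_smul, ← add_assoc, ← hy]
      have h0 := mul_nonneg hs.1 (hA0 y hs₀)
      have hcs : s * ⟪y, u⟫ ≤ τ * c := mul_le_mul hs.2 (hAc y hs₀) (hA0 y hs₀) hτ.le
      have hs2 : s ^ 2 ≤ τ ^ 2 := pow_le_pow_left₀ hs.1 hs.2 2
      have hge : 1 ≤ ‖y + s • u‖ := by
        rw [← sq_le_sq₀ zero_le_one (norm_nonneg _), hsq]
        nlinarith [sq_nonneg s]
      refine ⟨hge, ?_, ?_⟩
      · rw [← sq_lt_sq₀ (norm_nonneg _) (by linarith), hsq]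
        nlinarith [mul_nonneg hc hτ.le, sq_nonneg (c * τ + τ ^ 2), pow_pos hτ 2]
      · refine mem_cthickening_of_dist_le _ y _ _ hs₀ ?_
        have := dist_inv_norm_smul_le hge hy1.ge
        rw [hy1, inv_one, one_smul] at this
        refine this.trans ?_
        rw [dist_eq_norm, add_sub_cancel_left, norm_smul, hu, mul_one, Real.norm_eq_abs,
          abs_of_nonneg hs.1]
        exact hs.2
  have hfin : μHE[d - 1] X ≠ ∞ := by
    intro htop
    have := key 1 one_pos
    rw [htop, ENNReal.mul_top (by simp), ENNReal.mul_top (by simpa using hd.ne'), _root_.top_add,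
      top_le_iff] at this
    exact ENNReal.mul_ne_top ENNReal.ofReal_ne_top (measure_ne_top _ _) this
  have keyr : ∀ τ : ℝ, 0 < τ → d * (μHE[d - 1]).real X ≤
      τ⁻¹ * ((1 + c * τ + τ ^ 2) ^ d - 1) * (sphereMeasure E).real (cthickening τ A) := by
    intro τ hτ
    have hR : 0 ≤ 1 + c * τ + τ ^ 2 := by positivity
    have := ENNReal.toReal_mono (ENNReal.mul_ne_top ENNReal.ofReal_ne_top (measure_ne_top _ _))
      (key τ hτ)
    rw [ENNReal.toReal_add (ENNReal.mul_ne_top (by simp)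
      (ENNReal.mul_ne_top ENNReal.ofReal_ne_top hfin)) (measure_ne_top _ _)] at this
    simp only [ENNReal.toReal_mul, ENNReal.toReal_natCast, ENNReal.toReal_ofReal hτ.le,
      ENNReal.toReal_ofReal (pow_nonneg hR d)] at this
    rw [← Measure.real, ← Measure.real] at this
    rw [mul_assoc, ← div_eq_inv_mul, le_div_iff₀ hτ]
    linarith
  -- After division by `τ`, the limit `τ → 0` turns the shell factor into the derivative `d * c`,
  -- and the thickenings shrink to the compact set `A`.
  have hder : HasDerivAt (fun τ : ℝ => (1 + c * τ + τ ^ 2) ^ d) (d * c) 0 := by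
    have h1 : HasDerivAt (fun τ : ℝ => 1 + c * τ + τ ^ 2) c 0 := by
      have := (((hasDerivAt_id (0 : ℝ)).const_mul c).const_add 1).add
        ((hasDerivAt_id (0 : ℝ)).pow 2)
      simpa using! this
    simpa using! h1.pow d
  have hlim1 : Tendsto (fun τ : ℝ => τ⁻¹ * ((1 + c * τ + τ ^ 2) ^ d - 1)) (𝓝[>] 0)
      (𝓝 (d * c)) := by
    have := hder.tendsto_slope_zero_right
    simpa using this
  have hlim2 : Tendsto (fun τ : ℝ => (sphereMeasure E).real (cthickening τ A)) (𝓝[>] 0)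
      (𝓝 ((sphereMeasure E).real A)) := by
    have := tendsto_measure_cthickening_of_isCompact (μ := sphereMeasure E) hA
    exact ((ENNReal.tendsto_toReal (measure_ne_top _ _)).comp this).mono_left nhdsWithin_le_nhds
  have hle := ge_of_tendsto (hlim1.mul hlim2)
    (eventually_mem_nhdsWithin.mono fun τ hτ => keyr τ hτ)
  have hd' : (0 : ℝ) < d := by exact_mod_cast hd
  have hle' : (μHE[d - 1]).real X ≤ c * (sphereMeasure E).real A :=
    le_of_mul_le_mul_left (by linarith) hd'
  rw [← ENNReal.ofReal_toReal hfin, ← ENNReal.ofReal_toReal (measure_ne_top (sphereMeasure E) A),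
    ← ENNReal.ofReal_mul hc]
  exact ENNReal.ofReal_le_ofReal hle'

end

/-! ### Polar-coordinate measure and Hausdorff measure agree on the sphere. -/

section

variable {E : Type*} [NormedAddCommGroup E] [InnerProductSpace ℝ E]

/-- The closed disc of radius `ρ` around the origin orthogonal to `u`. -/
def orthogonalDisc (u : E) (ρ : ℝ) : Set E := {x | ⟪x, u⟫ = 0 ∧ ‖x‖ ≤ ρ}

theorem isClosed_orthogonalDisc (u : E) (ρ : ℝ) : IsClosed (orthogonalDisc u ρ) :=
  (isClosed_eq (by fun_prop) continuous_const).inter (isClosed_le continuous_norm continuous_const)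

theorem smul_orthogonalDisc (u : E) {ρ : ℝ} (hρ : 0 < ρ) :
    orthogonalDisc u ρ = ρ • orthogonalDisc u 1 := by
  ext x
  rw [mem_smul_set_iff_inv_smul_mem₀ hρ.ne']
  simp only [orthogonalDisc, mem_ofPred_eq, real_inner_smul_left, norm_smul, norm_inv,
    Real.norm_eq_abs, abs_of_pos hρ, inv_mul_le_iff₀ hρ, mul_one, mul_eq_zero, inv_eq_zero,
    hρ.ne', false_or]

theorem closedBall_inter_sphere_eq {y : E} (hy : ‖y‖ = 1) {r : ℝ} (hr : 0 ≤ r) :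
    closedBall y r ∩ sphere 0 1 = {x | ‖x‖ = 1 ∧ 1 - r ^ 2 / 2 ≤ ⟪x, y⟫} := by
  ext x
  rw [mem_inter_iff, mem_sphere_zero_iff_norm, mem_closedBall, dist_eq_norm, and_comm]
  refine and_congr_right fun hx => ?_
  rw [← sq_le_sq₀ (norm_nonneg _) hr, norm_sub_sq_real, hx, hy]
  constructor <;> intro h <;> linarith

variable [MeasurableSpace E] [BorelSpace E] [FiniteDimensional ℝ E]

omit [FiniteDimensional ℝ E] in
theorem euclideanHausdorffMeasure_orthogonalDisc (u : E) {ρ : ℝ} (hρ : 0 < ρ) (d : ℕ) :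
    μHE[d] (orthogonalDisc u ρ) = ENNReal.ofReal (ρ ^ d) * μHE[d] (orthogonalDisc u 1) := by
  rw [smul_orthogonalDisc u hρ, euclideanHausdorffMeasure_smul₀ _ hρ.ne', ENNReal.smul_def,
    smul_eq_mul, ENNReal.ofReal_pow hρ.le, ← Real.enorm_eq_ofReal hρ.le, ENNReal.coe_pow]
  rfl

theorem euclideanHausdorffMeasure_orthogonalDisc_pos_finite {u : E} (hu : ‖u‖ = 1) :
    μHE[finrank ℝ E - 1] (orthogonalDisc u 1) ≠ 0 ∧
      μHE[finrank ℝ E - 1] (orthogonalDisc u 1) ≠ ∞ := by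
  have hu0 : u ≠ 0 := by rintro rfl; simp at hu
  have hr : finrank ℝ (ℝ ∙ u)ᗮ = finrank ℝ E - 1 := by
    have := (ℝ ∙ u).finrank_add_finrank_orthogonal
    rw [finrank_span_singleton hu0] at this
    omega
  have h1 : orthogonalDisc u 1 = (Subtype.val : (ℝ ∙ u)ᗮ → E) '' closedBall 0 1 := by
    ext x
    simp [orthogonalDisc, Submodule.mem_orthogonal_singleton_iff_inner_left, and_comm]
  have h2 : μHE[finrank ℝ E - 1] (orthogonalDisc u 1) =
      volume (closedBall (0 : (ℝ ∙ u)ᗮ) 1) := by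
    rw [h1, isometry_subtype_coe.euclideanHausdorffMeasure_image, ← hr,
      InnerProductSpace.euclideanHausdorffMeasure_eq_volume]
  rw [h2]
  exact ⟨(measure_closedBall_pos _ _ one_pos).ne', measure_closedBall_lt_top.ne⟩

section caps

variable {y : E} (hy : ‖y‖ = 1) {r : ℝ} (hr : 0 < r) (hr1 : r < 1)
include hy hr hr1

/-- A cap projects orthogonally onto the smaller disc and is the radial image of part of the larger
one, placed in the tangent plane at `y`. Both surface measures obey the same two bounds, and the
ratio of the radii, `1 - r ^ 2 / 2`, tends to `1`. -/
theorem euclideanHausdorffMeasure_cap_bounds :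
    (μHE[finrank ℝ E - 1] (orthogonalDisc y √(1 - (1 - r ^ 2 / 2) ^ 2)) ≤
        μHE[finrank ℝ E - 1] (closedBall y r ∩ sphere 0 1) ∧
      μHE[finrank ℝ E - 1] (orthogonalDisc y √(1 - (1 - r ^ 2 / 2) ^ 2)) ≤
        sphereMeasure E (closedBall y r ∩ sphere 0 1)) ∧
    (μHE[finrank ℝ E - 1] (closedBall y r ∩ sphere 0 1) ≤
        μHE[finrank ℝ E - 1] (orthogonalDisc y (√(1 - (1 - r ^ 2 / 2) ^ 2) / (1 - r ^ 2 / 2))) ∧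
      sphereMeasure E (closedBall y r ∩ sphere 0 1) ≤
        μHE[finrank ℝ E - 1]
          (orthogonalDisc y (√(1 - (1 - r ^ 2 / 2) ^ 2) / (1 - r ^ 2 / 2)))) := by
  have hcompact : IsCompact (closedBall y r ∩ sphere 0 1) :=
    (isCompact_closedBall y r).inter_right isClosed_sphere
  have hcap := closedBall_inter_sphere_eq hy hr.le
  set a := 1 - r ^ 2 / 2 with ha
  have ha0 : 0 < a := by nlinarith
  have ha1 : a < 1 := by nlinarith
  have hq : 0 ≤ 1 - a ^ 2 := by nlinarith
  have hyy : ⟪y, y⟫ = 1 := by simp [hy]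
  have hlift : ∀ x ∈ orthogonalDisc y √(1 - a ^ 2), ∃ s : ℝ,
      x + s • y ∈ closedBall y r ∩ sphere 0 1 := by
    rintro x ⟨hx, hxn⟩
    have hx2 : ‖x‖ ^ 2 ≤ 1 - a ^ 2 := (Real.le_sqrt (norm_nonneg _) hq).1 hxn
    have h1 : a ^ 2 ≤ 1 - ‖x‖ ^ 2 := by linarith
    have h2 : 0 ≤ 1 - ‖x‖ ^ 2 := (sq_nonneg a).trans h1
    refine ⟨√(1 - ‖x‖ ^ 2), ?_⟩
    rw [hcap]
    refine ⟨?_, ?_⟩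
    · rw [← sq_eq_sq₀ (norm_nonneg _) zero_le_one, norm_add_sq_real, norm_smul, hy,
        real_inner_smul_right, hx, Real.norm_eq_abs, mul_one, sq_abs, Real.sq_sqrt h2]
      ring
    · rw [inner_add_left, hx, real_inner_smul_left, hyy, zero_add, mul_one]
      exact Real.le_sqrt_of_sq_le h1
  have htan : ∀ θ ∈ closedBall y r ∩ sphere 0 1, ⟪⟪θ, y⟫⁻¹ • θ - y, y⟫ = 0 ∧
      ‖⟪θ, y⟫⁻¹ • θ - y‖ ≤ √(1 - a ^ 2) / a ∧ 0 < ⟪θ, y⟫ ∧ ⟪θ, y⟫ ≤ 1 := by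
    intro θ hθ
    rw [hcap] at hθ
    obtain ⟨hθ1, hθa⟩ := hθ
    have hpos : 0 < ⟪θ, y⟫ := ha0.trans_le hθa
    have hle : ⟪θ, y⟫ ≤ 1 := by
      have := real_inner_le_norm θ y
      rwa [hθ1, hy, one_mul] at this
    refine ⟨?_, ?_, hpos, hle⟩
    · rw [inner_sub_left, real_inner_smul_left, hyy, inv_mul_cancel₀ hpos.ne', sub_self]
    · rw [le_div_iff₀ ha0]
      refine Real.le_sqrt_of_sq_le ?_
      rw [mul_pow, norm_sub_sq_real, norm_smul, hθ1, hy, real_inner_smul_left,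
        inv_mul_cancel₀ hpos.ne', norm_inv, Real.norm_eq_abs, abs_of_pos hpos, mul_one, inv_pow]
      have h3 : (⟪θ, y⟫ ^ 2)⁻¹ * a ^ 2 ≤ 1 := by
        rw [inv_mul_le_iff₀ (by positivity), mul_one]
        exact pow_le_pow_left₀ ha0.le hθa 2
      linarith
  refine ⟨⟨?_, ?_⟩, ?_, ?_⟩
  · exact euclideanHausdorffMeasure_le_of_lift hy (fun x hx => hx.1) hlift _
  · have := euclideanHausdorffMeasure_le_mul_sphereMeasure hy zero_le_one
      (X := orthogonalDisc y √(1 - a ^ 2)) (fun x hx => hx.1)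
      (isClosed_orthogonalDisc _ _).measurableSet hcompact inter_subset_right
      (fun θ hθ => (htan θ hθ).2.2.1.le) (fun θ hθ => (htan θ hθ).2.2.2) hlift
    simpa using this
  · have hiso : Isometry fun x : E => y + x := isometry_add_left y
    rw [← hiso.euclideanHausdorffMeasure_image (orthogonalDisc y _)]
    refine le_trans (measure_mono ?_) ((lipschitzOnWith_inv_norm_smul.mono
      ?_).euclideanHausdorffMeasure_image_le _)
    · intro θ hθ
      obtain ⟨h1, h2, h3, h4⟩ := htan θ hθ
      refine ⟨⟪θ, y⟫⁻¹ • θ, ⟨⟪θ, y⟫⁻¹ • θ - y, ⟨h1, h2⟩, by simp⟩, ?_⟩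
      simp only [norm_smul, mem_sphere_zero_iff_norm.1 hθ.2, mul_one, norm_inv, Real.norm_eq_abs,
        abs_of_pos h3, inv_inv, smul_smul, mul_inv_cancel₀ h3.ne', one_smul]
    · rintro _ ⟨x, ⟨hx, -⟩, rfl⟩
      simp only [mem_ofPred_eq]
      rw [← sq_le_sq₀ zero_le_one (norm_nonneg _), norm_add_sq_real, real_inner_comm, hx, hy]
      nlinarith [sq_nonneg ‖x‖]
  · have hiso : Isometry fun x : E => y + x := isometry_add_left y
    have := pow_mul_sphereMeasure_le hy one_pos
      (X := (fun x : E => y + x) '' orthogonalDisc y (√(1 - a ^ 2) / a)) (r := 1)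
      (D := closedBall y r ∩ sphere 0 1) ?_ ?_ hcompact.measurableSet one_pos ?_
    · simpa [hiso.euclideanHausdorffMeasure_image] using this
    · rintro _ ⟨x, ⟨hx, -⟩, rfl⟩
      simp [inner_add_left, hx, hy]
    · exact (hiso.isClosedEmbedding.isClosedMap _ (isClosed_orthogonalDisc _ _)).measurableSet
    · intro θ hθ
      obtain ⟨h1, h2, h3, h4⟩ := htan θ hθ
      exact ⟨⟪θ, y⟫⁻¹, (one_le_inv₀ h3).2 h4, ⟪θ, y⟫⁻¹ • θ - y, ⟨h1, h2⟩, by simp⟩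

theorem euclideanHausdorffMeasure_cap_finite :
    μHE[finrank ℝ E - 1] (closedBall y r ∩ sphere 0 1) ≠ ∞ := by
  have ha : 0 < 1 - r ^ 2 / 2 := by nlinarith
  have ha1 : 1 - r ^ 2 / 2 < 1 := by nlinarith
  refine ne_top_of_le_ne_top ?_ (euclideanHausdorffMeasure_cap_bounds hy hr hr1).2.1
  rw [euclideanHausdorffMeasure_orthogonalDisc _
    (div_pos (Real.sqrt_pos.2 (by nlinarith)) ha)]
  exact ENNReal.mul_ne_top ENNReal.ofReal_ne_top
    (euclideanHausdorffMeasure_orthogonalDisc_pos_finite hy).2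

theorem cap_measures_pos :
    μHE[finrank ℝ E - 1] (closedBall y r ∩ sphere 0 1) ≠ 0 ∧
      sphereMeasure E (closedBall y r ∩ sphere 0 1) ≠ 0 := by
  have ha : 0 < 1 - r ^ 2 / 2 := by nlinarith
  have ha1 : 1 - r ^ 2 / 2 < 1 := by nlinarith
  obtain ⟨⟨h1, h2⟩, -⟩ := euclideanHausdorffMeasure_cap_bounds hy hr hr1
  have hs : 0 < √(1 - (1 - r ^ 2 / 2) ^ 2) := Real.sqrt_pos.2 (by nlinarith)
  have h3 : μHE[finrank ℝ E - 1] (orthogonalDisc y √(1 - (1 - r ^ 2 / 2) ^ 2)) ≠ 0 := by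
    rw [euclideanHausdorffMeasure_orthogonalDisc _ hs]
    exact mul_ne_zero (ENNReal.ofReal_pos.2 (pow_pos hs _)).ne'
      (euclideanHausdorffMeasure_orthogonalDisc_pos_finite hy).1
  exact ⟨(h3.bot_lt.trans_le h1).ne', (h3.bot_lt.trans_le h2).ne'⟩

theorem cap_measures_compare :
    ENNReal.ofReal ((1 - r ^ 2 / 2) ^ (finrank ℝ E - 1)) *
        μHE[finrank ℝ E - 1] (closedBall y r ∩ sphere 0 1) ≤
      sphereMeasure E (closedBall y r ∩ sphere 0 1) ∧
    ENNReal.ofReal ((1 - r ^ 2 / 2) ^ (finrank ℝ E - 1)) *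
        sphereMeasure E (closedBall y r ∩ sphere 0 1) ≤
      μHE[finrank ℝ E - 1] (closedBall y r ∩ sphere 0 1) := by
  obtain ⟨⟨h1, h2⟩, h3, h4⟩ := euclideanHausdorffMeasure_cap_bounds hy hr hr1
  have ha : 0 < 1 - r ^ 2 / 2 := by nlinarith
  have ha1 : 1 - r ^ 2 / 2 < 1 := by nlinarith
  set a := 1 - r ^ 2 / 2
  have hs : 0 < √(1 - a ^ 2) := Real.sqrt_pos.2 (by nlinarith)
  have h5 : ENNReal.ofReal (a ^ (finrank ℝ E - 1)) *
      μHE[finrank ℝ E - 1] (orthogonalDisc y (√(1 - a ^ 2) / a)) =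
      μHE[finrank ℝ E - 1] (orthogonalDisc y √(1 - a ^ 2)) := by
    rw [euclideanHausdorffMeasure_orthogonalDisc _ (div_pos hs ha),
      euclideanHausdorffMeasure_orthogonalDisc _ hs, ← mul_assoc,
      ← ENNReal.ofReal_mul (by positivity), ← mul_pow, mul_div_cancel₀ _ ha.ne']
  exact ⟨(mul_le_mul_right h3 _).trans (h5.le.trans h2),
    (mul_le_mul_right h4 _).trans (h5.le.trans h1)⟩

end caps

omit [MeasurableSpace E] [BorelSpace E] [FiniteDimensional ℝ E] in
theorem tendsto_div_of_mul_le {ι : Type*} {l : Filter ι} {q : ι → ℝ} (hq : Tendsto q l (𝓝 1))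
    {f g : ι → ℝ≥0∞} (hg0 : ∀ᶠ i in l, g i ≠ 0) (hgt : ∀ᶠ i in l, g i ≠ ∞)
    (hqf : ∀ᶠ i in l, ENNReal.ofReal (q i) * f i ≤ g i)
    (hqg : ∀ᶠ i in l, ENNReal.ofReal (q i) * g i ≤ f i) :
    Tendsto (fun i => f i / g i) l (𝓝 1) := by
  have h1 : Tendsto (fun i => ENNReal.ofReal (q i)) l (𝓝 1) := by
    simpa using! (ENNReal.continuous_ofReal.tendsto 1).comp hq
  have h2 : Tendsto (fun i => (ENNReal.ofReal (q i))⁻¹) l (𝓝 1) := by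
    simpa using tendsto_inv_iff.2 h1
  have hpos : ∀ᶠ i in l, 0 < q i := hq.eventually (lt_mem_nhds one_pos)
  refine tendsto_of_tendsto_of_tendsto_of_le_of_le' h1 h2 ?_ ?_
  · filter_upwards [hg0, hgt, hqg] with i h0 ht h
    rwa [ENNReal.le_div_iff_mul_le (Or.inl h0) (Or.inl ht)]
  · filter_upwards [hpos, hqf] with i hp h
    refine ENNReal.div_le_of_le_mul ?_
    rw [mul_comm, ← div_eq_mul_inv, ENNReal.le_div_iff_mul_le
      (Or.inl (ENNReal.ofReal_pos.2 hp).ne') (Or.inl ENNReal.ofReal_ne_top), mul_comm]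
    exact h

/-- By Besicovitch differentiation the limit is the Radon–Nikodym derivative. A part of `ρ` singular
to `μ` stays invisible, so only an inequality results; it is used in both directions. -/
theorem le_of_ae_tendsto_closedBall_div {μ ρ : Measure E} [IsLocallyFiniteMeasure μ]
    [IsLocallyFiniteMeasure ρ] (h : ∀ᵐ x ∂μ, Tendsto
      (fun r => ρ (closedBall x r) / μ (closedBall x r)) (𝓝[>] 0) (𝓝 1)) : μ ≤ ρ := by
  have h1 : ρ.rnDeriv μ =ᵐ[μ] 1 := by
    filter_upwards [h, Besicovitch.ae_tendsto_rnDeriv ρ μ] with x hx hx'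
    exact tendsto_nhds_unique hx' hx
  calc μ = μ.withDensity 1 := withDensity_one.symm
    _ = μ.withDensity (ρ.rnDeriv μ) := withDensity_congr_ae h1.symm
    _ ≤ ρ := withDensity_rnDeriv_le ρ μ

/-- The surface measure of the unit sphere is the normalised Hausdorff measure. -/
theorem sphereMeasure_eq_restrict :
    sphereMeasure E = μHE[finrank ℝ E - 1].restrict (sphere 0 1) := by
  have hcl : ∀ y : E, ∀ r : ℝ, μHE[finrank ℝ E - 1].restrict (sphere 0 1) (closedBall y r) =
      μHE[finrank ℝ E - 1] (closedBall y r ∩ sphere 0 1) := fun y r =>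
    Measure.restrict_apply isClosed_closedBall.measurableSet
  -- Differentiation of measures needs local finiteness, which for Hausdorff measure comes from the
  -- cap bounds.
  have hfin : IsLocallyFiniteMeasure (μHE[finrank ℝ E - 1].restrict (sphere (0 : E) 1)) := by
    refine ⟨fun y => ?_⟩
    by_cases hy : ‖y‖ = 1
    · refine ⟨closedBall y (1 / 2), closedBall_mem_nhds _ (by norm_num), ?_⟩
      rw [hcl]
      exact (euclideanHausdorffMeasure_cap_finite hy (by norm_num) (by norm_num)).lt_top
    · refine ⟨(sphere 0 1)ᶜ, isClosed_sphere.isOpen_compl.mem_nhds (by simpa using hy), ?_⟩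
      rw [Measure.restrict_apply isClosed_sphere.measurableSet.compl]
      simp
  have hlim : Tendsto (fun r : ℝ => (1 - r ^ 2 / 2) ^ (finrank ℝ E - 1)) (𝓝[>] 0) (𝓝 1) := by
    have : Continuous fun r : ℝ => (1 - r ^ 2 / 2) ^ (finrank ℝ E - 1) := by fun_prop
    simpa using (this.tendsto 0).mono_left nhdsWithin_le_nhds
  have hev : ∀ᶠ r : ℝ in 𝓝[>] 0, 0 < r ∧ r < 1 :=
    eventually_mem_nhdsWithin.and (mem_nhdsWithin_of_mem_nhds (gt_mem_nhds one_pos))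
  refine le_antisymm (le_of_ae_tendsto_closedBall_div ?_) (le_of_ae_tendsto_closedBall_div ?_)
  · have hae : ∀ᵐ y ∂(sphereMeasure E), y ∈ sphere (0 : E) 1 := by
      have := sphereMeasure_inter_sphere (E := E) (sphere 0 1)ᶜ
      rw [compl_inter_self, measure_empty] at this
      exact this.symm
    filter_upwards [hae] with y hy
    have hy1 := mem_sphere_zero_iff_norm.1 hy
    simp_rw [hcl, ← sphereMeasure_inter_sphere (closedBall y _)]
    refine tendsto_div_of_mul_le hlim ?_ ?_ ?_ ?_ <;> filter_upwards [hev] with r hr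
    · exact (cap_measures_pos hy1 hr.1 hr.2).2
    · exact measure_ne_top _ _
    · exact (cap_measures_compare hy1 hr.1 hr.2).1
    · exact (cap_measures_compare hy1 hr.1 hr.2).2
  · filter_upwards [ae_restrict_mem isClosed_sphere.measurableSet] with y hy
    have hy1 := mem_sphere_zero_iff_norm.1 hy
    simp_rw [hcl, ← sphereMeasure_inter_sphere (closedBall y _)]
    refine tendsto_div_of_mul_le hlim ?_ ?_ ?_ ?_ <;> filter_upwards [hev] with r hr
    · exact (cap_measures_pos hy1 hr.1 hr.2).1
    · exact euclideanHausdorffMeasure_cap_finite hy1 hr.1 hr.2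
    · exact (cap_measures_compare hy1 hr.1 hr.2).2
    · exact (cap_measures_compare hy1 hr.1 hr.2).1

theorem sphereMeasure_eq {A : Set E} (hA : A ⊆ sphere 0 1)
    (hAm : MeasurableSet A) : sphereMeasure E A = μHE[finrank ℝ E - 1] A := by
  rw [sphereMeasure_eq_restrict, Measure.restrict_apply hAm, inter_eq_self_of_subset_left hA]

end

/-! ### Lifting faces to the sphere: the part of the boundary inside the ball. -/

section

variable {E : Type*} [NormedAddCommGroup E] [InnerProductSpace ℝ E]
variable [MeasurableSpace E] [BorelSpace E] [FiniteDimensional ℝ E]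

/-- A hyperplane meets the sphere in a null set. -/
theorem euclideanHausdorffMeasure_sphere_inter_hyperplane (hd : 2 ≤ finrank ℝ E) {u : E}
    (hu : ‖u‖ = 1) (h : ℝ) :
    μHE[finrank ℝ E - 1] (sphere (0 : E) 1 ∩ {x | ⟪x, u⟫ = h}) = 0 := by
  have hu0 : u ≠ 0 := by rintro rfl; simp at hu
  have huu : ⟪u, u⟫ = 1 := by simp [hu]
  have hr : finrank ℝ (ℝ ∙ u)ᗮ = finrank ℝ E - 1 := by
    have := (ℝ ∙ u).finrank_add_finrank_orthogonal
    rw [finrank_span_singleton hu0] at this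
    omega
  -- The section is a sphere in `uᗮ`, possibly of radius `0`, and it is null because `uᗮ` has
  -- positive dimension; this is where `2 ≤ finrank ℝ E` matters.
  have : Nontrivial (ℝ ∙ u)ᗮ := finrank_pos_iff.1 (by omega : 0 < finrank ℝ (ℝ ∙ u)ᗮ)
  have hiso : Isometry fun x : (ℝ ∙ u)ᗮ => h • u + (x : E) :=
    (isometry_add_left (h • u)).comp isometry_subtype_coe
  refine measure_mono_null (t := (fun x : (ℝ ∙ u)ᗮ => h • u + (x : E)) '' sphere 0 √(1 - h ^ 2))
    ?_ ?_
  · rintro x ⟨hx1, hx⟩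
    rw [mem_sphere_zero_iff_norm] at hx1
    have hx' : ⟪x, u⟫ = h := hx
    refine ⟨⟨x - h • u, ?_⟩, ?_, by simp⟩
    · rw [Submodule.mem_orthogonal_singleton_iff_inner_left, inner_sub_left, real_inner_smul_left,
        huu, hx']
      ring
    · rw [mem_sphere_zero_iff_norm, Submodule.coe_norm, ← Real.sqrt_sq (norm_nonneg _)]
      congr 1
      rw [norm_sub_sq_real, norm_smul, hx1, hu, real_inner_smul_right, hx', Real.norm_eq_abs,
        mul_one, sq_abs]
      ring
  · rw [hiso.euclideanHausdorffMeasure_image, ← hr,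
      InnerProductSpace.euclideanHausdorffMeasure_eq_volume]
    exact addHaar_sphere _ _ _

theorem euclideanHausdorffMeasure_lt_top_of_flat {u : E} (hu : ‖u‖ = 1) {h : ℝ} {X : Set E}
    (hX : ∀ x ∈ X, ⟪x, u⟫ = h) (hb : Bornology.IsBounded X) :
    μHE[finrank ℝ E - 1] X < ∞ := by
  obtain ⟨R, hR⟩ := isBounded_iff_forall_norm_le.1 hb
  have hiso : Isometry fun x : E => h • u + x := isometry_add_left _
  have hpos : 0 < |R| + |h| + 1 := by positivity
  refine (measure_mono (t := (fun x : E => h • u + x) '' orthogonalDisc u (|R| + |h| + 1))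
    ?_).trans_lt ?_
  · intro x hx
    refine ⟨x - h • u, ⟨?_, ?_⟩, by simp⟩
    · rw [inner_sub_left, real_inner_smul_left, hX x hx]
      simp [hu]
    · calc ‖x - h • u‖ ≤ ‖x‖ + ‖h • u‖ := norm_sub_le _ _
        _ ≤ |R| + |h| := by
          rw [norm_smul, hu, mul_one, Real.norm_eq_abs]
          gcongr
          exact (hR x hx).trans (le_abs_self R)
        _ ≤ _ := by linarith
  · rw [hiso.euclideanHausdorffMeasure_image, euclideanHausdorffMeasure_orthogonalDisc u hpos]
    exact ENNReal.mul_lt_top ENNReal.ofReal_lt_top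
      (euclideanHausdorffMeasure_orthogonalDisc_pos_finite hu).2.lt_top

/-- The vertical lift of a point of the hyperplane `⟪x, u⟫ = h` to the upper half of the unit
sphere. -/
noncomputable def sphereLift (u : E) (h : ℝ) (x : E) : E := x + (√(1 - ‖x‖ ^ 2 + h ^ 2) - h) • u

omit [MeasurableSpace E] [BorelSpace E] [FiniteDimensional ℝ E]

theorem continuous_sphereLift (u : E) (h : ℝ) : Continuous (sphereLift u h) := by
  unfold sphereLift; fun_prop

theorem inner_sphereLift {u : E} (hu : ‖u‖ = 1) {h : ℝ} {x : E} (hx : ⟪x, u⟫ = h) :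
    ⟪sphereLift u h x, u⟫ = √(1 - ‖x‖ ^ 2 + h ^ 2) := by
  rw [sphereLift, inner_add_left, real_inner_smul_left, hx, real_inner_self_eq_norm_sq, hu]
  ring

theorem norm_sphereLift {u : E} (hu : ‖u‖ = 1) {h : ℝ} {x : E} (hx : ⟪x, u⟫ = h)
    (hx1 : ‖x‖ ≤ 1) : ‖sphereLift u h x‖ = 1 := by
  have h0 : 0 ≤ 1 - ‖x‖ ^ 2 + h ^ 2 := by nlinarith [norm_nonneg x, sq_nonneg h]
  rw [← sq_eq_sq₀ (norm_nonneg _) zero_le_one, sphereLift, norm_add_sq_real, norm_smul, hu,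
    real_inner_smul_right, hx, Real.norm_eq_abs, mul_one, sq_abs]
  linarith [Real.sq_sqrt h0]

omit [InnerProductSpace ℝ E] in
theorem sqrt_sub_pos {x : E} (hx : ‖x‖ < 1) (h : ℝ) : 0 < √(1 - ‖x‖ ^ 2 + h ^ 2) - h := by
  rw [sub_pos]
  have : 0 < 1 - ‖x‖ ^ 2 := by nlinarith [norm_nonneg x]
  exact Real.lt_sqrt_of_sq_lt (by linarith)

variable [MeasurableSpace E] [BorelSpace E] [FiniteDimensional ℝ E]

omit [InnerProductSpace ℝ E] [MeasurableSpace E] [BorelSpace E] [FiniteDimensional ℝ E] in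
theorem ball_eq_iUnion_closedBall_one_sub (x : E) :
    ball x 1 = ⋃ k : ℕ, closedBall x (1 - 1 / ((k : ℝ) + 1)) := by
  ext y
  rw [mem_iUnion, mem_ball]
  constructor
  · intro hy
    obtain ⟨k, hk⟩ := exists_nat_one_div_lt (sub_pos.2 hy)
    exact ⟨k, mem_closedBall.2 (by linarith)⟩
  · rintro ⟨k, hk⟩
    have : 0 < 1 / ((k : ℝ) + 1) := by positivity
    linarith [mem_closedBall.1 hk]

theorem measurableSet_image_inter_ball {F : Set E} (hF : IsClosed F) {f : E → E}
    (hf : Continuous f) : MeasurableSet (f '' (F ∩ ball 0 1)) := by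
  rw [ball_eq_iUnion_closedBall_one_sub, inter_iUnion, image_iUnion]
  exact MeasurableSet.iUnion fun k =>
    (((isCompact_closedBall _ _).inter_left hF).image hf).measurableSet

/-- The part of a flat set inside the ball compared with its lift to the sphere, with a gain on a
set where the sphere is inclined. -/
theorem euclideanHausdorffMeasure_inter_ball_le {u : E} (hu : ‖u‖ = 1) {h : ℝ} {F : Set E}
    (hF : ∀ x ∈ F, ⟪x, u⟫ = h) (hFc : IsClosed F) {G : Set E} (hG : IsClosed G) {c : ℝ}
    (hc : 0 ≤ c) (hGc : ∀ y ∈ G, ⟪y, u⟫ ≤ c) :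
    μHE[finrank ℝ E - 1] (F ∩ ball 0 1) ≤
      (μHE[finrank ℝ E - 1].restrict Gᶜ + ENNReal.ofReal c • μHE[finrank ℝ E - 1].restrict G)
        (sphereLift u h '' (F ∩ ball 0 1)) := by
  set m := μHE[finrank ℝ E - 1].restrict Gᶜ + ENNReal.ofReal c • μHE[finrank ℝ E - 1].restrict G
    with hm
  have hmono : Monotone fun k : ℕ => F ∩ closedBall (0 : E) (1 - 1 / ((k : ℝ) + 1)) := by
    intro i j hij
    have : 1 / ((j : ℝ) + 1) ≤ 1 / ((i : ℝ) + 1) := by gcongr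
    exact inter_subset_inter_right _ (closedBall_subset_closedBall (by linarith))
  -- The comparison with a gain needs a compact lift, so the open ball is exhausted by closed balls.
  conv_lhs => rw [ball_eq_iUnion_closedBall_one_sub, inter_iUnion, hmono.measure_iUnion]
  refine iSup_le fun k => ?_
  have hsub : F ∩ closedBall (0 : E) (1 - 1 / ((k : ℝ) + 1)) ⊆ F ∩ ball 0 1 := by
    rw [ball_eq_iUnion_closedBall_one_sub]
    exact inter_subset_inter_right _ (subset_iUnion
      (fun k : ℕ => closedBall (0 : E) (1 - 1 / ((k : ℝ) + 1))) k)
  refine le_trans ?_ (measure_mono (image_mono hsub))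
  set K := F ∩ closedBall (0 : E) (1 - 1 / ((k : ℝ) + 1)) with hK
  have hKc : IsCompact K := (isCompact_closedBall _ _).inter_left hFc
  have hcont := continuous_sphereLift u h
  set A := sphereLift u h '' K with hA
  have hAc : IsCompact A := hKc.image hcont
  have hAm : m A = μHE[finrank ℝ E - 1] (A \ G) +
      ENNReal.ofReal c * μHE[finrank ℝ E - 1] (A ∩ G) := by
    rw [hm, Measure.add_apply, Measure.smul_apply, Measure.restrict_apply hAc.measurableSet,
      Measure.restrict_apply hAc.measurableSet, smul_eq_mul, sdiff_eq]
  have hAS : A ⊆ sphere 0 1 := by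
    rintro _ ⟨x, hx, rfl⟩
    exact mem_sphere_zero_iff_norm.2
      (norm_sphereLift hu (hF x hx.1) (mem_ball_zero_iff.1 (hsub hx).2).le)
  -- Points whose lift misses `G` only use that projections contract; points whose lift lies in `G`
  -- gain the factor `c`.
  rw [hAm, ← measure_sdiff_add_inter K (hG.preimage hcont).measurableSet]
  gcongr ?_ + ?_
  · refine euclideanHausdorffMeasure_le_of_lift hu (h := h) (fun x hx => hF x hx.1.1) ?_ _
    rintro x ⟨hx, hxG⟩
    exact ⟨_, mem_image_of_mem _ hx, hxG⟩
  · rw [← sphereMeasure_eq (inter_subset_left.trans hAS)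
      (hAc.measurableSet.inter hG.measurableSet)]
    refine euclideanHausdorffMeasure_le_mul_sphereMeasure hu (h := h) hc
      (fun x hx => hF x hx.1.1) (hKc.measurableSet.inter (hG.preimage hcont).measurableSet)
      (hAc.inter_right hG) (inter_subset_left.trans hAS) ?_ (fun y hy => hGc y hy.2) ?_
    · rintro _ ⟨⟨x, hx, rfl⟩, -⟩
      rw [inner_sphereLift hu (hF x hx.1)]
      positivity
    · rintro x ⟨hx, hxG⟩
      exact ⟨_, mem_image_of_mem _ hx, hxG⟩

/-- A compact set whose boundary consists, up to a null set, of faces with outer unit normals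
`u ∈ U`. -/
structure HasFaces (P : Set E) (U : Finset E) (h : E → ℝ) : Prop where
  isCompact : IsCompact P
  norm_eq_one : ∀ u ∈ U, ‖u‖ = 1
  inner_le : ∀ u ∈ U, ∀ x ∈ P, ⟪x, u⟫ ≤ h u
  frontier_ae : μHE[finrank ℝ E - 1] (frontier P \ ⋃ u ∈ U, {x ∈ P | ⟪x, u⟫ = h u}) = 0
  aedisjoint : ∀ u ∈ U, ∀ v ∈ U, u ≠ v →
    μHE[finrank ℝ E - 1] ({x ∈ P | ⟪x, u⟫ = h u} ∩ {x ∈ P | ⟪x, v⟫ = h v}) = 0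

namespace HasFaces

variable {P : Set E} {U : Finset E} {h : E → ℝ} (hP : HasFaces P U h)
include hP

omit [FiniteDimensional ℝ E] in
theorem isClosed_face (u : E) : IsClosed {x ∈ P | ⟪x, u⟫ = h u} :=
  hP.isCompact.isClosed.inter (isClosed_eq (by fun_prop) continuous_const)

omit [FiniteDimensional ℝ E] in
theorem face_subset_frontier {u : E} (hu : u ∈ U) : {x ∈ P | ⟪x, u⟫ = h u} ⊆ frontier P := by
  rintro x ⟨hx, hxu⟩
  rw [hP.isCompact.isClosed.frontier_eq]
  refine ⟨hx, fun hint => ?_⟩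
  have hcont : Tendsto (fun t : ℝ => x + t • u) (𝓝[>] 0) (𝓝 x) := by
    have : Continuous fun t : ℝ => x + t • u := by fun_prop
    simpa using (this.tendsto 0).mono_left nhdsWithin_le_nhds
  obtain ⟨t, ht, ht0⟩ := ((hcont.eventually (mem_interior_iff_mem_nhds.1 hint)).and
    eventually_mem_nhdsWithin).exists
  have := hP.inner_le u hu _ ht
  rw [inner_add_left, hxu, real_inner_smul_left, real_inner_self_eq_norm_sq,
    hP.norm_eq_one u hu] at this
  have ht0' : 0 < t := ht0
  linarith

theorem frontier_lt_top : μHE[finrank ℝ E - 1] (frontier P) < ∞ := by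
  refine (measure_le_inter_add_sdiff _ _ (⋃ u ∈ U, {x ∈ P | ⟪x, u⟫ = h u})).trans_lt ?_
  rw [hP.frontier_ae, add_zero]
  refine (measure_mono inter_subset_right).trans_lt
    ((measure_biUnion_finset_le _ _).trans_lt (ENNReal.sum_lt_top.2 fun u hu => ?_))
  exact euclideanHausdorffMeasure_lt_top_of_flat (hP.norm_eq_one u hu) (fun x hx => hx.2)
    (hP.isCompact.isBounded.subset fun x hx => hx.1)

omit [FiniteDimensional ℝ E] in
-- Outward normal rays from different faces do not meet. If `x + s • u = y + t • v`, the supporting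
-- inequalities give `⟪y - x, u⟫ ≤ 0 ≤ ⟪y - x, v⟫`, and `y - x = s • u - t • v` makes `‖y - x‖ ^ 2 ≤
-- 0`. Then `s • u = t • v` with `s, t > 0`, so the unit vectors agree.
theorem sphereLift_disjoint {u v : E} (hu : u ∈ U) (hv : v ∈ U) (huv : u ≠ v) :
    Disjoint (sphereLift u (h u) '' ({x ∈ P | ⟪x, u⟫ = h u} ∩ ball 0 1))
      (sphereLift v (h v) '' ({x ∈ P | ⟪x, v⟫ = h v} ∩ ball 0 1)) := by
  rw [Set.disjoint_left]
  rintro _ ⟨x, ⟨⟨hxP, hxu⟩, hxb⟩, rfl⟩ ⟨y, ⟨⟨hyP, hyv⟩, hyb⟩, hxy⟩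
  have hs := sqrt_sub_pos (mem_ball_zero_iff.1 hxb) (h u)
  have ht := sqrt_sub_pos (mem_ball_zero_iff.1 hyb) (h v)
  simp only [sphereLift] at hxy
  set s := √(1 - ‖x‖ ^ 2 + h u ^ 2) - h u
  set t := √(1 - ‖y‖ ^ 2 + h v ^ 2) - h v
  have h1 : ⟪y - x, u⟫ ≤ 0 := by
    rw [inner_sub_left, hxu]; linarith [hP.inner_le u hu y hyP]
  have h2 : 0 ≤ ⟪y - x, v⟫ := by
    rw [inner_sub_left, hyv]; linarith [hP.inner_le v hv x hxP]
  have h3 : y - x = s • u - t • v := by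
    rw [sub_eq_sub_iff_add_eq_add, hxy, add_comm]
  have h4 : ⟪y - x, y - x⟫ ≤ 0 := by
    nth_rewrite 2 [h3]
    rw [inner_sub_right, real_inner_smul_right, real_inner_smul_right]
    nlinarith
  have h5 : y - x = 0 := by
    rwa [real_inner_self_eq_norm_sq, sq_nonpos_iff, norm_eq_zero] at h4
  rw [h5, eq_comm, sub_eq_zero] at h3
  have h6 : s = t := by
    have := congrArg norm h3
    rwa [norm_smul, norm_smul, hP.norm_eq_one u hu, hP.norm_eq_one v hv, mul_one, mul_one,
      Real.norm_eq_abs, Real.norm_eq_abs, abs_of_pos hs, abs_of_pos ht] at this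
  rw [← h6] at h3
  exact huv (smul_right_injective _ hs.ne' h3)

/-- The lifts of the faces are disjoint and lie beyond their supporting hyperplanes, hence in
`sphere 0 1 \ P`. The facewise estimates therefore add up, for the measure that weights `G` by `c`.
-/
theorem frontier_inter_ball_le {G : Set E} (hG : IsClosed G) {c : ℝ} (hc : 0 ≤ c)
    (hGc : ∀ y ∈ G, ∀ u ∈ U, ⟪y, u⟫ ≤ c) :
    μHE[finrank ℝ E - 1] (frontier P ∩ ball 0 1) ≤
      μHE[finrank ℝ E - 1] ((sphere 0 1 \ P) \ G) +
        ENNReal.ofReal c * μHE[finrank ℝ E - 1] ((sphere 0 1 \ P) ∩ G) := by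
  set m := μHE[finrank ℝ E - 1].restrict Gᶜ + ENNReal.ofReal c • μHE[finrank ℝ E - 1].restrict G
    with hm
  let A : E → Set E := fun u => sphereLift u (h u) '' ({x ∈ P | ⟪x, u⟫ = h u} ∩ ball 0 1)
  have hmS : m (sphere 0 1 \ P) = μHE[finrank ℝ E - 1] ((sphere 0 1 \ P) \ G) +
        ENNReal.ofReal c * μHE[finrank ℝ E - 1] ((sphere 0 1 \ P) ∩ G) := by
    have : MeasurableSet (sphere 0 1 \ P) :=
      isClosed_sphere.measurableSet.diff hP.isCompact.measurableSet
    rw [hm, Measure.add_apply, Measure.smul_apply, Measure.restrict_apply this,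
      Measure.restrict_apply this, smul_eq_mul, sdiff_eq (_ \ _)]
  rw [← hmS]
  calc μHE[finrank ℝ E - 1] (frontier P ∩ ball 0 1)
      ≤ μHE[finrank ℝ E - 1] ((⋃ u ∈ U, {x ∈ P | ⟪x, u⟫ = h u} ∩ ball 0 1) ∪
          (frontier P \ ⋃ u ∈ U, {x ∈ P | ⟪x, u⟫ = h u})) := by
        refine measure_mono fun x hx => ?_
        by_cases hxU : x ∈ ⋃ u ∈ U, {x ∈ P | ⟪x, u⟫ = h u}
        · left
          simp only [mem_iUnion] at hxU ⊢
          obtain ⟨u, hu, hxu⟩ := hxU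
          exact ⟨u, hu, hxu, hx.2⟩
        · exact Or.inr ⟨hx.1, hxU⟩
    _ ≤ μHE[finrank ℝ E - 1] (⋃ u ∈ U, {x ∈ P | ⟪x, u⟫ = h u} ∩ ball 0 1) + 0 := by
        rw [← hP.frontier_ae]
        exact measure_union_le _ _
    _ ≤ ∑ u ∈ U, μHE[finrank ℝ E - 1] ({x ∈ P | ⟪x, u⟫ = h u} ∩ ball 0 1) := by
        rw [add_zero]
        exact measure_biUnion_finset_le _ _
    _ ≤ ∑ u ∈ U, m (A u) := Finset.sum_le_sum fun u hu =>
        euclideanHausdorffMeasure_inter_ball_le (hP.norm_eq_one u hu) (fun x hx => hx.2)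
          (hP.isClosed_face u) hG hc fun y hy => hGc y hy u hu
    _ = m (⋃ u ∈ U, A u) := by
        rw [measure_biUnion_finset]
        · exact fun u hu v hv huv => hP.sphereLift_disjoint hu hv huv
        · exact fun u _ =>
            measurableSet_image_inter_ball (hP.isClosed_face u) (continuous_sphereLift u (h u))
    _ ≤ m (sphere 0 1 \ P) := by
        refine measure_mono (iUnion₂_subset fun u hu => ?_)
        rintro _ ⟨x, ⟨⟨hxP, hxu⟩, hxb⟩, rfl⟩
        have hxb' := mem_ball_zero_iff.1 hxb
        have hu1 := hP.norm_eq_one u hu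
        refine ⟨mem_sphere_zero_iff_norm.2 (norm_sphereLift hu1 hxu hxb'.le), fun hmem => ?_⟩
        have := hP.inner_le u hu _ hmem
        rw [inner_sphereLift hu1 hxu] at this
        linarith [sqrt_sub_pos hxb' (h u)]

end HasFaces

end

/-! ### Radial projection: the part of the boundary outside the ball. -/

section

variable {E : Type*} [NormedAddCommGroup E] [InnerProductSpace ℝ E]

/-- A ray starting on the sphere at a point of a compact set leaves that set at a boundary point. -/
theorem exists_smul_mem_frontier {P : Set E} (hP : IsCompact P) {θ : E} (hθ : ‖θ‖ = 1)
    (hθP : θ ∈ P) : ∃ t : ℝ, 1 ≤ t ∧ t • θ ∈ frontier P := by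
  obtain ⟨R, hR⟩ := isBounded_iff_forall_norm_le.1 hP.isBounded
  have hcont : Continuous fun t : ℝ => t • θ := by fun_prop
  have hT : IsCompact (Icc 1 R ∩ (fun t : ℝ => t • θ) ⁻¹' P) :=
    isCompact_Icc.inter_right (hP.isClosed.preimage hcont)
  have hmem : ∀ t : ℝ, 1 ≤ t → t • θ ∈ P → t ∈ Icc 1 R ∩ (fun t : ℝ => t • θ) ⁻¹' P := by
    intro t ht htP
    refine ⟨⟨ht, ?_⟩, htP⟩
    have := hR _ htP
    rw [norm_smul, hθ, mul_one, Real.norm_eq_abs] at this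
    exact (le_abs_self t).trans this
  -- The last parameter at which the ray is in `P` gives a boundary point.
  obtain ⟨t, ht, hmax⟩ := hT.exists_isGreatest ⟨1, hmem 1 le_rfl (by simpa using hθP)⟩
  refine ⟨t, ht.1.1, ?_⟩
  rw [hP.isClosed.frontier_eq]
  refine ⟨ht.2, fun hint => ?_⟩
  have hnhds : (fun t : ℝ => t • θ) ⁻¹' P ∈ 𝓝[>] t :=
    mem_nhdsWithin_of_mem_nhds (hcont.continuousAt (mem_interior_iff_mem_nhds.1 hint))
  obtain ⟨s, hs, hts⟩ := (Filter.inter_mem hnhds self_mem_nhdsWithin : _ ∩ Ioi t ∈ 𝓝[>] t) |>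
    Filter.nonempty_of_mem
  have hts' : t < s := hts
  exact absurd (hmax (hmem s (ht.1.1.trans hts'.le) hs)) (not_le.2 hts')

variable [MeasurableSpace E] [BorelSpace E] [FiniteDimensional ℝ E]

/-- A low hyperplane, `h ≤ k`, gains through its obliqueness: the cone formula carries the factor
`h`. A high one, `h > k`, gains through its distance: `t * ⟪θ, u⟫ = h` forces `t ≥ h / k ^ 2`, and
already the square of this ratio is enough, whence dimension at least `2`. -/
theorem sphereMeasure_le_of_face (hd : 2 ≤ finrank ℝ E) {u : E} (hu : ‖u‖ = 1) {h : ℝ} (hh : 0 < h)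
    {X : Set E} (hX : ∀ x ∈ X, ⟪x, u⟫ = h) (hXm : MeasurableSet X) {D : Set E}
    (hD : MeasurableSet D) (hDX : ∀ θ ∈ D, ∃ t : ℝ, 1 ≤ t ∧ t • θ ∈ X) {k : ℝ} (hk : 0 < k)
    (hk1 : k ≤ 1) (hDk : ∀ θ ∈ D, ⟪θ, u⟫ ≤ k ^ 2) :
    sphereMeasure E D ≤ ENNReal.ofReal k * μHE[finrank ℝ E - 1] X := by
  rcases le_or_gt h k with hhk | hhk
  · have := pow_mul_sphereMeasure_le hu hh hX hXm hD one_pos hDX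
    rw [one_pow, ENNReal.ofReal_one, one_mul] at this
    exact this.trans (by gcongr)
  · have hr : 1 ≤ h / k ^ 2 := by
      rw [le_div_iff₀ (by positivity)]; nlinarith
    have := pow_mul_sphereMeasure_le hu hh hX hXm hD (r := h / k ^ 2) (by positivity) (by
      intro θ hθ
      obtain ⟨t, ht, htX⟩ := hDX θ hθ
      refine ⟨t, ?_, htX⟩
      rw [div_le_iff₀ (by positivity), ← hX _ htX, real_inner_smul_left]
      exact mul_le_mul_of_nonneg_left (hDk θ hθ) (by linarith))
    have hle : h ≤ (h / k ^ 2) ^ finrank ℝ E * k := by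
      calc h ≤ (h / k ^ 2) ^ 2 * k := by
            rw [div_pow, div_mul_eq_mul_div, le_div_iff₀ (by positivity)]
            have h3 : k ^ 2 ≤ 1 := pow_le_one₀ hk.le hk1
            have h4 : (k ^ 2) ^ 2 ≤ k * h := by
              linarith [mul_nonneg (sq_nonneg k) (sub_nonneg.2 h3),
                mul_nonneg hk.le (sub_nonneg.2 hhk.le)]
            linarith [mul_le_mul_of_nonneg_left h4 hh.le]
        _ ≤ _ := by gcongr
    have h2 : ENNReal.ofReal ((h / k ^ 2) ^ finrank ℝ E) * sphereMeasure E D ≤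
        ENNReal.ofReal ((h / k ^ 2) ^ finrank ℝ E) *
          (ENNReal.ofReal k * μHE[finrank ℝ E - 1] X) := by
      refine this.trans ?_
      rw [← mul_assoc, ← ENNReal.ofReal_mul (by positivity)]
      gcongr
    rwa [ENNReal.mul_le_mul_iff_right (ENNReal.ofReal_pos.2 (by positivity)).ne'
      ENNReal.ofReal_ne_top] at h2

namespace HasFaces

variable {P : Set E} {U : Finset E} {h : E → ℝ} (hP : HasFaces P U h)
include hP

/-- Each point of the sphere in `P` is the radial image of a boundary point outside the open ball.
Faces with `h u > 0` are compared one by one; all others contribute only null sets. It is used with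
`k = 1` off `G` and with `k < 1` on `G`. -/
theorem sphere_inter_le (hd : 2 ≤ finrank ℝ E) {T : Set E} (hT : MeasurableSet T) {k : ℝ}
    (hk : 0 < k) (hk1 : k ≤ 1) (hTk : ∀ y ∈ T ∩ sphere 0 1, ∀ u ∈ U, ⟪y, u⟫ ≤ k ^ 2) :
    μHE[finrank ℝ E - 1] (sphere 0 1 ∩ P ∩ T) ≤
      ENNReal.ofReal k *
        μHE[finrank ℝ E - 1] ((frontier P \ ball 0 1) ∩ (fun x => ‖x‖⁻¹ • x) ⁻¹' T) := by
  have hπ : Measurable fun x : E => ‖x‖⁻¹ • x := measurable_norm.inv.smul measurable_id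
  have hnorm : ∀ x : E, x ∉ ball (0 : E) 1 → 1 ≤ ‖x‖ := fun x hx => by simpa using hx
  have hcont : ContinuousOn (fun x : E => ‖x‖⁻¹ • x) {x | 1 ≤ ‖x‖} :=
    lipschitzOnWith_inv_norm_smul.continuousOn
  have hmem : ∀ (θ : E) (t : ℝ), ‖θ‖ = 1 → 1 ≤ t → ‖t • θ‖⁻¹ • t • θ = θ := by
    intro θ t hθ ht
    rw [norm_smul, hθ, mul_one, Real.norm_eq_abs, abs_of_pos (by linarith), smul_smul,
      inv_mul_cancel₀ (by linarith), one_smul]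
  let F : E → Set E := fun u => {x ∈ P | ⟪x, u⟫ = h u} \ ball 0 1
  have hFc : ∀ u, IsCompact (F u) := fun u =>
    (hP.isCompact.of_isClosed_subset (hP.isClosed_face u) fun x hx => hx.1).diff isOpen_ball
  let X : E → Set E := fun u => F u ∩ (fun x => ‖x‖⁻¹ • x) ⁻¹' T
  have hXm : ∀ u, MeasurableSet (X u) := fun u => (hFc u).measurableSet.inter (hπ hT)
  let D : E → Set E := fun u => ((fun x : E => ‖x‖⁻¹ • x) '' F u) ∩ T
  have hDm : ∀ u, MeasurableSet (D u) := fun u =>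
    ((hFc u).image_of_continuousOn (hcont.mono fun x hx => hnorm x hx.2)).measurableSet.inter hT
  have hDS : ∀ u, D u ⊆ sphere 0 1 := by
    rintro u _ ⟨⟨x, hx, rfl⟩, -⟩
    have := hnorm x hx.2
    rw [mem_sphere_zero_iff_norm, norm_smul, norm_inv, norm_norm, inv_mul_cancel₀ (by linarith)]
  have hDX : ∀ u, ∀ θ ∈ D u, ∃ t : ℝ, 1 ≤ t ∧ t • θ ∈ X u := by
    rintro u _ ⟨⟨x, hx, rfl⟩, hxT⟩
    have := hnorm x hx.2
    refine ⟨‖x‖, this, ?_⟩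
    simp only [smul_smul]
    rw [mul_inv_cancel₀ (by linarith), one_smul]
    exact ⟨hx, hxT⟩
  have hface : ∀ u ∈ U, 0 < h u → μHE[finrank ℝ E - 1] (D u) ≤
      ENNReal.ofReal k * μHE[finrank ℝ E - 1] (X u) := by
    intro u hu hh
    rw [← sphereMeasure_eq (hDS u) (hDm u)]
    exact sphereMeasure_le_of_face hd (hP.norm_eq_one u hu) hh (fun x hx => hx.1.1.2) (hXm u)
      (hDm u) (hDX u) hk hk1 fun θ hθ => hTk θ ⟨hθ.2, hDS u hθ⟩ u hu
  set Z := frontier P \ ⋃ u ∈ U, {x ∈ P | ⟪x, u⟫ = h u} with hZ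
  have hZ0 : μHE[finrank ℝ E - 1] ((fun x : E => ‖x‖⁻¹ • x) '' (Z \ ball 0 1)) = 0 := by
    refine le_antisymm (((lipschitzOnWith_inv_norm_smul.mono
      fun x hx => hnorm x hx.2).euclideanHausdorffMeasure_image_le _).trans ?_) zero_le
    exact (measure_mono sdiff_subset).trans hP.frontier_ae.le
  have hN : μHE[finrank ℝ E - 1] (⋃ u ∈ U, (sphere (0 : E) 1 ∩ {x | ⟪x, u⟫ = 0}) ∪
      (sphere (0 : E) 1 ∩ {x | ⟪x, u⟫ = h u})) = 0 := by
    refine (measure_biUnion_null_iff U.countable_toSet).2 ?_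
    intro u hu
    exact measure_union_null
      (euclideanHausdorffMeasure_sphere_inter_hyperplane hd (hP.norm_eq_one u hu) _)
      (euclideanHausdorffMeasure_sphere_inter_hyperplane hd (hP.norm_eq_one u hu) _)
  have hcover : sphere 0 1 ∩ P ∩ T ⊆ (⋃ u ∈ U.filter (0 < h ·), D u) ∪
      ((fun x : E => ‖x‖⁻¹ • x) '' (Z \ ball 0 1) ∪
        ⋃ u ∈ U, (sphere (0 : E) 1 ∩ {x | ⟪x, u⟫ = 0}) ∪
          (sphere (0 : E) 1 ∩ {x | ⟪x, u⟫ = h u})) := by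
    rintro θ ⟨⟨hθ, hθP⟩, hθT⟩
    have hθ1 := mem_sphere_zero_iff_norm.1 hθ
    obtain ⟨t, ht, htP⟩ := exists_smul_mem_frontier hP.isCompact hθ1 hθP
    have htb : t • θ ∉ ball (0 : E) 1 := by
      rw [mem_ball_zero_iff, norm_smul, hθ1, mul_one, Real.norm_eq_abs, not_lt]
      exact ht.trans (le_abs_self t)
    by_cases htU : t • θ ∈ ⋃ u ∈ U, {x ∈ P | ⟪x, u⟫ = h u}
    · simp only [mem_iUnion] at htU
      obtain ⟨u, hu, htu⟩ := htU
      rcases lt_or_ge 0 (h u) with hh | hh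
      · left
        simp only [mem_iUnion, Finset.mem_filter]
        exact ⟨u, ⟨hu, hh⟩, ⟨t • θ, ⟨htu, htb⟩, hmem θ t hθ1 ht⟩, hθT⟩
      -- If `h u < 0`, then `⟪θ, u⟫ ≤ h u = t * ⟪θ, u⟫` and `t ≥ 1` force `⟪θ, u⟫ = h u`; if `h u =
      -- 0`, then `⟪θ, u⟫ = 0`. Either way `θ` lies in a null hyperplane section.
      · right; right
        simp only [mem_iUnion]
        refine ⟨u, hu, ?_⟩
        have h1 : t * ⟪θ, u⟫ = h u := by rw [← real_inner_smul_left]; exact htu.2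
        have h2 := hP.inner_le u hu θ hθP
        rcases hh.lt_or_eq with hneg | hzero
        · exact Or.inr ⟨hθ, show ⟪θ, u⟫ = h u by nlinarith⟩
        · refine Or.inl ⟨hθ, ?_⟩
          rw [hzero] at h1
          exact (mul_eq_zero.1 h1).resolve_left (by linarith)
    · exact Or.inr (Or.inl ⟨t • θ, ⟨⟨htP, htU⟩, htb⟩, hmem θ t hθ1 ht⟩)
  calc μHE[finrank ℝ E - 1] (sphere 0 1 ∩ P ∩ T)
      ≤ μHE[finrank ℝ E - 1] (⋃ u ∈ U.filter (0 < h ·), D u) + 0 := by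
        refine (measure_mono hcover).trans ((measure_union_le _ _).trans ?_)
        rw [measure_union_null hZ0 hN]
    _ ≤ ∑ u ∈ U.filter (0 < h ·), μHE[finrank ℝ E - 1] (D u) := by
        rw [add_zero]
        exact measure_biUnion_finset_le _ _
    _ ≤ ∑ u ∈ U.filter (0 < h ·), ENNReal.ofReal k * μHE[finrank ℝ E - 1] (X u) :=
        Finset.sum_le_sum fun u hu =>
          hface u (Finset.mem_filter.1 hu).1 (Finset.mem_filter.1 hu).2
    _ = ENNReal.ofReal k * μHE[finrank ℝ E - 1] (⋃ u ∈ U.filter (0 < h ·), X u) := by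
        rw [← Finset.mul_sum, measure_biUnion_finset₀]
        · intro u hu v hv huv
          refine measure_mono_null ?_ (hP.aedisjoint u (Finset.mem_filter.1 hu).1 v
            (Finset.mem_filter.1 hv).1 huv)
          exact inter_subset_inter (fun x hx => hx.1.1) (fun x hx => hx.1.1)
        · exact fun u _ => (hXm u).nullMeasurableSet
    _ ≤ _ := by
        gcongr
        exact iUnion₂_subset fun u hu x hx =>
          ⟨⟨hP.face_subset_frontier (Finset.mem_filter.1 hu).1 hx.1.1, hx.1.2⟩, hx.2⟩

theorem frontier_inter_sphere (hd : 2 ≤ finrank ℝ E) :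
    μHE[finrank ℝ E - 1] (frontier P ∩ sphere 0 1) = 0 := by
  refine measure_mono_null (t := (frontier P \ ⋃ u ∈ U, {x ∈ P | ⟪x, u⟫ = h u}) ∪
    ⋃ u ∈ U, (sphere (0 : E) 1 ∩ {x | ⟪x, u⟫ = h u})) ?_ (measure_union_null hP.frontier_ae ?_)
  · rintro x ⟨hx, hxS⟩
    by_cases hxU : x ∈ ⋃ u ∈ U, {x ∈ P | ⟪x, u⟫ = h u}
    · right
      simp only [mem_iUnion] at hxU ⊢
      obtain ⟨u, hu, hxu⟩ := hxU
      exact ⟨u, hu, hxS, hxu.2⟩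
    · exact Or.inl ⟨hx, hxU⟩
  · refine (measure_biUnion_null_iff U.countable_toSet).2 ?_
    exact fun u hu =>
      euclideanHausdorffMeasure_sphere_inter_hyperplane hd (hP.norm_eq_one u hu) _

/-- The surface area deviation from the ball is controlled from below by the part of the sphere
that is far away from all normals. -/
theorem mul_sphere_inter_le_deviation (hd : 2 ≤ finrank ℝ E) {G : Set E} (hG : IsClosed G)
    (hGS : G ⊆ sphere 0 1) {k : ℝ} (hk : 0 < k) (hk1 : k ≤ 1)
    (hGk : ∀ y ∈ G, ∀ u ∈ U, ⟪y, u⟫ ≤ k ^ 2) :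
    (1 - k) * μHE[finrank ℝ E - 1].real G ≤
      μHE[finrank ℝ E - 1].real (frontier (closedBall 0 1 ∪ P)) -
        μHE[finrank ℝ E - 1].real (frontier (closedBall 0 1 ∩ P)) := by
  set H := (μHE[finrank ℝ E - 1] : Measure E) with hH
  have : Nontrivial E := finrank_pos_iff.1 (by omega : 0 < finrank ℝ E)
  have hS : frontier (closedBall (0 : E) 1) = sphere 0 1 := frontier_closedBall _ one_ne_zero
  have hSfin : H (sphere 0 1) < ∞ := by
    rw [hH, ← sphereMeasure_eq subset_rfl isClosed_sphere.measurableSet]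
    exact measure_lt_top _ _
  have hPfin : H (frontier P) < ∞ := hP.frontier_lt_top
  have hPm := hP.isCompact.measurableSet
  have hPc := hP.isCompact.isClosed
  have hSm : MeasurableSet (sphere (0 : E) 1) := isClosed_sphere.measurableSet
  have hUfin : ∀ A ⊆ sphere 0 1 ∪ frontier P, H A ≠ ∞ := fun A hA =>
    ((measure_mono hA).trans_lt ((measure_union_le _ _).trans_lt
      (ENNReal.add_lt_top.2 ⟨hSfin, hPfin⟩))).ne
  have hπ : Measurable fun x : E => ‖x‖⁻¹ • x := measurable_norm.inv.smul measurable_id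
  -- lower bound for the union
  have h1 : H.real (sphere 0 1 \ P) + H.real (frontier P \ ball 0 1) ≤
      H.real (frontier (closedBall 0 1 ∪ P)) := by
    -- Passing from the open to the closed ball costs nothing, since `frontier P` meets the sphere
    -- in a null set.
    have e1 : H.real (frontier P \ ball 0 1) = H.real (frontier P \ closedBall 0 1) := by
      refine le_antisymm ?_ (measureReal_mono (sdiff_subset_sdiff_right ball_subset_closedBall)
        (hUfin _ (sdiff_subset.trans subset_union_right)))
      have : frontier P \ ball 0 1 ⊆ (frontier P \ closedBall 0 1) ∪ (frontier P ∩ sphere 0 1) := by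
        rintro x ⟨hx, hxb⟩
        by_cases hxc : x ∈ closedBall (0 : E) 1
        · refine Or.inr ⟨hx, ?_⟩
          rw [mem_sphere]
          exact le_antisymm (mem_closedBall.1 hxc) (not_lt.1 hxb)
        · exact Or.inl ⟨hx, hxc⟩
      refine (measureReal_mono this (hUfin _ ?_)).trans ((measureReal_union_le _ _).trans ?_)
      · exact union_subset (sdiff_subset.trans subset_union_right)
          (inter_subset_left.trans subset_union_right)
      · rw [measureReal_def H (frontier P ∩ _), hP.frontier_inter_sphere hd]
        simp
    rw [e1, ← measureReal_union ?_ ?_ (hUfin _ (sdiff_subset.trans subset_union_left))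
      (hUfin _ (sdiff_subset.trans subset_union_right))]
    · refine measureReal_mono ?_ (hUfin _ ?_)
      · rintro x (⟨hx, hxP⟩ | ⟨hx, hxB⟩)
        · rw [← hS, isClosed_closedBall.frontier_eq] at hx
          rw [(isClosed_closedBall.union hPc).frontier_eq]
          refine ⟨Or.inl hx.1, fun hint => hx.2 ?_⟩
          rw [mem_interior_iff_mem_nhds] at hint ⊢
          filter_upwards [hint, hPc.isOpen_compl.mem_nhds hxP] with y hy hyP
          exact hy.resolve_right hyP
        · rw [hPc.frontier_eq] at hx
          rw [(isClosed_closedBall.union hPc).frontier_eq]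
          refine ⟨Or.inr hx.1, fun hint => hx.2 ?_⟩
          rw [mem_interior_iff_mem_nhds] at hint ⊢
          filter_upwards [hint, isClosed_closedBall.isOpen_compl.mem_nhds hxB] with y hy hyB
          exact hy.resolve_left hyB
      · refine (frontier_union_subset _ _).trans ?_
        rw [hS]
        exact union_subset_union inter_subset_left inter_subset_right
    · rw [Set.disjoint_left]
      exact fun x hx hx' => hx'.2 (sphere_subset_closedBall hx.1)
    · exact isClosed_frontier.measurableSet.diff isClosed_closedBall.measurableSet
  -- upper bound for the intersection
  have h2 : H.real (frontier (closedBall 0 1 ∩ P)) ≤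
      H.real (sphere 0 1 ∩ P) + H.real (frontier P ∩ ball 0 1) := by
    refine le_trans (measureReal_mono ?_ (hUfin _ ?_)) (measureReal_union_le _ _)
    · intro x hx
      have hxBP : x ∈ closedBall 0 1 ∩ P := by
        have := frontier_subset_closure hx
        rwa [(isClosed_closedBall.inter hPc).closure_eq] at this
      by_cases hxb : x ∈ ball (0 : E) 1
      · refine Or.inr ⟨?_, hxb⟩
        have := frontier_inter_subset _ _ hx
        rcases this with h3 | h3
        · rw [hS] at h3
          exact absurd hxb (by simpa using h3.1.ge)
        · exact h3.2
      · refine Or.inl ⟨?_, hxBP.2⟩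
        rw [mem_sphere]
        exact le_antisymm (mem_closedBall.1 hxBP.1) (not_lt.1 hxb)
    · exact union_subset_union inter_subset_left inter_subset_left
  have toR : ∀ {A B C : Set E} {c : ℝ}, 0 ≤ c → A ⊆ sphere 0 1 ∪ frontier P →
      B ⊆ sphere 0 1 ∪ frontier P → C ⊆ sphere 0 1 ∪ frontier P →
      H A ≤ H B + ENNReal.ofReal c * H C → H.real A ≤ H.real B + c * H.real C := by
    intro A B C c hc hA hB hC hle
    have := ENNReal.toReal_mono (ENNReal.add_ne_top.2
      ⟨hUfin B hB, ENNReal.mul_ne_top ENNReal.ofReal_ne_top (hUfin C hC)⟩) hle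
    rwa [ENNReal.toReal_add (hUfin B hB) (ENNReal.mul_ne_top ENNReal.ofReal_ne_top (hUfin C hC)),
      ENNReal.toReal_mul, ENNReal.toReal_ofReal hc] at this
  have hsp : ∀ A : Set E, sphere 0 1 ∩ A ⊆ sphere 0 1 ∪ frontier P := fun A =>
    inter_subset_left.trans subset_union_left
  have hfr : ∀ A : Set E, frontier P ∩ A ⊆ sphere 0 1 ∪ frontier P := fun A =>
    inter_subset_left.trans subset_union_right
  have h3 : H.real (frontier P ∩ ball 0 1) ≤
      H.real ((sphere 0 1 \ P) \ G) + k ^ 2 * H.real ((sphere 0 1 \ P) ∩ G) :=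
    toR (by positivity) (hfr _) (sdiff_subset.trans (hsp _)) (inter_subset_left.trans (hsp _))
      (hP.frontier_inter_ball_le hG (by positivity) hGk)
  have h4 : H.real (sphere 0 1 ∩ P ∩ Gᶜ) ≤
      H.real ((frontier P \ ball 0 1) ∩ (fun x => ‖x‖⁻¹ • x) ⁻¹' Gᶜ) := by
    have := toR (B := ∅) zero_le_one (inter_subset_left.trans (hsp _)) (empty_subset _)
      (inter_subset_left.trans (hfr _)) (by
        rw [measure_empty, zero_add]
        refine hP.sphere_inter_le hd (T := Gᶜ) hG.measurableSet.compl one_pos le_rfl ?_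
        intro y hy u hu
        refine (real_inner_le_norm _ _).trans ?_
        rw [hP.norm_eq_one u hu, mem_sphere_zero_iff_norm.1 hy.2]
        norm_num)
    rwa [measureReal_empty, zero_add, one_mul] at this
  have h5 : H.real (sphere 0 1 ∩ P ∩ G) ≤
      k * H.real ((frontier P \ ball 0 1) ∩ (fun x => ‖x‖⁻¹ • x) ⁻¹' G) := by
    have := toR (B := ∅) hk.le (inter_subset_left.trans (hsp _)) (empty_subset _)
      (inter_subset_left.trans (hfr _)) (by
        rw [measure_empty, zero_add]
        exact hP.sphere_inter_le hd hG.measurableSet hk hk1 fun y hy => hGk y hy.1)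
    rwa [measureReal_empty, zero_add] at this
  have h6 : H.real ((frontier P \ ball 0 1) ∩ (fun x => ‖x‖⁻¹ • x) ⁻¹' G) +
      H.real ((frontier P \ ball 0 1) ∩ (fun x => ‖x‖⁻¹ • x) ⁻¹' Gᶜ) =
      H.real (frontier P \ ball 0 1) := by
    rw [preimage_compl, ← Set.sdiff_eq]
    exact measureReal_inter_add_sdiff (hπ hG.measurableSet) (hUfin _ (hfr _))
  have h7 : H.real (sphere 0 1 ∩ P ∩ G) + H.real (sphere 0 1 ∩ P ∩ Gᶜ) =
      H.real (sphere 0 1 ∩ P) := by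
    rw [← Set.sdiff_eq]
    exact measureReal_inter_add_sdiff hG.measurableSet (hUfin _ (hsp _))
  have h8 : H.real ((sphere 0 1 \ P) ∩ G) + H.real ((sphere 0 1 \ P) \ G) =
      H.real (sphere 0 1 \ P) :=
    measureReal_inter_add_sdiff hG.measurableSet (hUfin _ (hsp _))
  have h9 : H.real (sphere 0 1 ∩ P ∩ G) + H.real ((sphere 0 1 \ P) ∩ G) = H.real G := by
    have e : ∀ A : Set E, sphere 0 1 ∩ A ∩ G = G ∩ A := by
      intro A
      ext x
      constructor
      · rintro ⟨⟨_, h⟩, h'⟩; exact ⟨h', h⟩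
      · rintro ⟨h', h⟩; exact ⟨⟨hGS h', h⟩, h'⟩
    rw [Set.sdiff_eq, e, e, ← Set.sdiff_eq]
    exact measureReal_inter_add_sdiff hPm (hUfin _ (hGS.trans subset_union_left))
  have n1 : 0 ≤ H.real ((sphere 0 1 \ P) ∩ G) := measureReal_nonneg
  have n2 : 0 ≤ H.real ((frontier P \ ball 0 1) ∩ (fun x => ‖x‖⁻¹ • x) ⁻¹' G) := measureReal_nonneg
  rw [← h9]
  -- The inner gain is at least `(1 - k ^ 2) ≥ 1 - k` times the measure of `(sphere 0 1 \ P) ∩ G`.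
  -- In the outer one, a boundary part of measure `x` lies over a part of `G` of measure `g ≤ k *
  -- x`, and `(2 - k) * k ≤ 1` gives `x - g ≥ (1 - k) * g`.
  have hk2 : k ^ 2 ≤ k := by nlinarith
  have m1 := mul_le_mul_of_nonneg_right hk2 n1
  have m2 := mul_nonneg (mul_self_nonneg (1 - k)) n2
  have m3 := mul_le_mul_of_nonneg_left h5 (by linarith : 0 ≤ 2 - k)
  linarith

end HasFaces

end

/-! ### Cap covering and the bound in terms of the number of faces. -/

section

variable {E : Type*} [NormedAddCommGroup E] [InnerProductSpace ℝ E]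
variable [MeasurableSpace E] [BorelSpace E] [FiniteDimensional ℝ E]

theorem sphereMeasure_univ : sphereMeasure E univ = finrank ℝ E * volume (ball (0 : E) 1) := by
  rw [sphereMeasure, map_apply measurable_subtype_coe MeasurableSet.univ, preimage_univ]
  have := (subsingleton_or_nontrivial E)
  rcases this with h | h
  · simp [finrank_zero_of_subsingleton]
  · exact toSphere_apply_univ _

/-- Upper bound for the measure of a spherical cap. -/
theorem sphereMeasure_closedBall_le (hd : finrank ℝ E ≠ 0) {u : E} {ε : ℝ}
    (hε : 0 < ε) (hε1 : ε < 1) :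
    (sphereMeasure E).real (closedBall u ε) ≤
      2 ^ finrank ℝ E * ε ^ (finrank ℝ E - 1) * (sphereMeasure E).real univ := by
  have : Nontrivial E := finrank_pos_iff.1 (Nat.pos_of_ne_zero hd)
  have h1ε : 0 < 1 - ε := by linarith
  -- The sector over the cap is its copy scaled by `1 - ε` together with a shell piece within `2 *
  -- ε` of `u`. Since `(1 - ε) ^ n ≤ 1 - ε` in dimension `n`, absorbing the scaled copy leaves `ε`
  -- times the cap measure on the left, which costs one power of `ε`.
  have hsub : Ioo (0 : ℝ) 1 • (closedBall u ε ∩ sphere 0 1) ⊆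
      Ioo (0 : ℝ) (1 - ε) • (closedBall u ε ∩ sphere 0 1) ∪ closedBall u (2 * ε) := by
    rintro _ ⟨t, ht, θ, hθ, rfl⟩
    rcases lt_or_ge t (1 - ε) with htε | htε
    · exact Or.inl ⟨t, ⟨ht.1, htε⟩, θ, hθ, rfl⟩
    · right
      have hθ1 := mem_sphere_zero_iff_norm.1 hθ.2
      have h2 := mem_closedBall.1 hθ.1
      rw [mem_closedBall]
      calc dist (t • θ) u ≤ dist (t • θ) θ + dist θ u := dist_triangle _ _ _
        _ ≤ ε + ε := by
          gcongr
          rw [dist_eq_norm, show t • θ - θ = (t - 1) • θ by module, norm_smul, hθ1, mul_one,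
            Real.norm_eq_abs, abs_le]
          constructor <;> linarith [ht.2]
        _ = 2 * ε := by ring
  have hle : sphereMeasure E (closedBall u ε) ≤
      ENNReal.ofReal ((1 - ε) ^ finrank ℝ E) * sphereMeasure E (closedBall u ε) +
        ENNReal.ofReal ((2 * ε) ^ finrank ℝ E) * sphereMeasure E univ := by
    have := (measure_mono hsub).trans (measure_union_le (μ := (volume : Measure E)) _ _)
    rw [volume_Ioo_smul h1ε, addHaar_closedBall _ _ (by positivity)] at this
    calc sphereMeasure E (closedBall u ε)
        ≤ finrank ℝ E * (_ + _) := by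
          rw [sphereMeasure_apply isClosed_closedBall.measurableSet]
          exact mul_le_mul_right this _
      _ = _ := by
          rw [sphereMeasure_univ, sphereMeasure_apply isClosed_closedBall.measurableSet]
          ring
  have hle' : (sphereMeasure E).real (closedBall u ε) ≤
      (1 - ε) ^ finrank ℝ E * (sphereMeasure E).real (closedBall u ε) +
        (2 * ε) ^ finrank ℝ E * (sphereMeasure E).real univ := by
    have t1 : ∀ (r : ℝ) (A : Set E), ENNReal.ofReal r * sphereMeasure E A ≠ ∞ := fun r A =>
      ENNReal.mul_ne_top ENNReal.ofReal_ne_top (measure_ne_top _ _)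
    have := ENNReal.toReal_mono (ENNReal.add_ne_top.2 ⟨t1 _ _, t1 _ _⟩) hle
    rwa [ENNReal.toReal_add (t1 _ _) (t1 _ _), ENNReal.toReal_mul, ENNReal.toReal_mul,
      ENNReal.toReal_ofReal (by positivity), ENNReal.toReal_ofReal (by positivity)] at this
  have hpow : (1 - ε) ^ finrank ℝ E ≤ 1 - ε := pow_le_of_le_one h1ε.le (by linarith) hd
  have n1 : 0 ≤ (sphereMeasure E).real (closedBall u ε) := measureReal_nonneg
  have hmul : ε * (sphereMeasure E).real (closedBall u ε) ≤
      ε * (2 ^ finrank ℝ E * ε ^ (finrank ℝ E - 1) * (sphereMeasure E).real univ) := by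
    calc ε * (sphereMeasure E).real (closedBall u ε)
        ≤ (2 * ε) ^ finrank ℝ E * (sphereMeasure E).real univ := by
          nlinarith [mul_le_mul_of_nonneg_right hpow n1]
      _ = _ := by
          rw [mul_pow, ← mul_pow_sub_one hd ε]; ring
  exact le_of_mul_le_mul_left hmul hε

/-- At least half of the sphere is at distance at least `ε` from a given finite set of not too many
points. -/
theorem half_sphere_le {U : Finset E} (hd : finrank ℝ E ≠ 0) {ε : ℝ}
    (hε : 0 < ε) (hε1 : ε < 1) (hcard : U.card * (2 ^ finrank ℝ E * ε ^ (finrank ℝ E - 1)) ≤ 1 / 2) :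
    (sphereMeasure E).real univ / 2 ≤
      (sphereMeasure E).real (sphere 0 1 ∩ {y | ∀ u ∈ U, ε ≤ dist y u}) := by
  have hsub : (univ : Set E) ∩ sphere 0 1 ⊆ (sphere 0 1 ∩ {y | ∀ u ∈ U, ε ≤ dist y u}) ∪
      ⋃ u ∈ U, closedBall u ε := by
    rintro y ⟨-, hy⟩
    by_cases h : ∀ u ∈ U, ε ≤ dist y u
    · exact Or.inl ⟨hy, h⟩
    · push Not at h
      obtain ⟨u, hu, hyu⟩ := h
      exact Or.inr (mem_iUnion₂.2 ⟨u, hu, mem_closedBall.2 hyu.le⟩)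
  have h1 : (sphereMeasure E).real univ = (sphereMeasure E).real (univ ∩ sphere 0 1) := by
    rw [measureReal_def, measureReal_def, sphereMeasure_inter_sphere]
  have h2 : (sphereMeasure E).real (⋃ u ∈ U, closedBall u ε) ≤ (sphereMeasure E).real univ / 2 := by
    calc (sphereMeasure E).real (⋃ u ∈ U, closedBall u ε)
        ≤ ∑ u ∈ U, (sphereMeasure E).real (closedBall u ε) := measureReal_biUnion_finset_le _ _
      _ ≤ ∑ u ∈ U, 2 ^ finrank ℝ E * ε ^ (finrank ℝ E - 1) * (sphereMeasure E).real univ :=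
          Finset.sum_le_sum fun u _ => sphereMeasure_closedBall_le hd hε hε1
      _ = U.card * (2 ^ finrank ℝ E * ε ^ (finrank ℝ E - 1)) * (sphereMeasure E).real univ := by
          rw [Finset.sum_const, nsmul_eq_mul]; ring
      _ ≤ 1 / 2 * (sphereMeasure E).real univ := by gcongr
      _ = _ := by ring
  have h3 := (measureReal_mono hsub).trans (measureReal_union_le (μ := sphereMeasure E) _ _)
  rw [← h1] at h3
  linarith

/-- Lower bound for the surface area deviation from the ball in terms of the number of facets. -/
theorem HasFaces.deviation_ge {P : Set E} {U : Finset E} {h : E → ℝ} (hP : HasFaces P U h)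
    (hd : 2 ≤ finrank ℝ E) {N : ℕ} (hN : 1 ≤ N) (hcard : U.card ≤ N) :
    1 / 512 * (μHE[finrank ℝ E - 1].real (sphere (0 : E) 1) /
        (N : ℝ) ^ (2 / ((finrank ℝ E : ℝ) - 1))) ≤
      μHE[finrank ℝ E - 1].real (frontier (closedBall 0 1 ∪ P)) -
        μHE[finrank ℝ E - 1].real (frontier (closedBall 0 1 ∩ P)) := by
  have hd0 : finrank ℝ E ≠ 0 := by omega
  obtain ⟨d, hdd⟩ : ∃ d, finrank ℝ E = d + 1 := ⟨finrank ℝ E - 1, by omega⟩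
  have hd1 : 1 ≤ d := by omega
  have hdR : (0 : ℝ) < d := by exact_mod_cast hd1
  have hNR : (1 : ℝ) ≤ N := by exact_mod_cast hN
  have hN0 : (0 : ℝ) < N := by linarith
  set q : ℝ := (N : ℝ) ^ (1 / (d : ℝ)) with hq
  have hq1 : 1 ≤ q := Real.one_le_rpow hNR (by positivity)
  have hqd : q ^ d = N := by
    rw [hq, ← Real.rpow_natCast, ← Real.rpow_mul hN0.le, one_div_mul_cancel hdR.ne', Real.rpow_one]
  have hq2 : (N : ℝ) ^ (2 / ((finrank ℝ E : ℝ) - 1)) = q ^ 2 := by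
    rw [hq, ← Real.rpow_natCast, ← Real.rpow_mul hN0.le, hdd]
    congr 1
    push_cast
    ring
  -- With `q ^ d = N` the caps cover at most the fraction `N * 2 ^ (d + 1) * ε ^ d = 2 * (1 / 4) ^ d
  -- ≤ 1 / 2` of the sphere.
  set ε : ℝ := 1 / (8 * q) with hε_def
  have hε : 0 < ε := by positivity
  have hε8 : ε ≤ 1 / 8 := by
    rw [hε_def]; gcongr; linarith
  have hcap : U.card * (2 ^ finrank ℝ E * ε ^ (finrank ℝ E - 1)) ≤ 1 / 2 := by
    calc (U.card : ℝ) * (2 ^ finrank ℝ E * ε ^ (finrank ℝ E - 1))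
        ≤ N * (2 ^ finrank ℝ E * ε ^ (finrank ℝ E - 1)) := by
          gcongr
      _ = 2 * (1 / 4) ^ d := by
          rw [hdd, Nat.add_sub_cancel, hε_def, div_pow, mul_pow, hqd, one_pow, pow_succ,
            show (8 : ℝ) = 2 * 4 by norm_num, mul_pow, div_pow, one_pow]
          field_simp
      _ ≤ 2 * (1 / 4) ^ 1 := by
          gcongr 2 * ?_
          exact pow_le_pow_of_le_one (by norm_num) (by norm_num) hd1
      _ = 1 / 2 := by norm_num
  set G := sphere (0 : E) 1 ∩ {y | ∀ u ∈ U, ε ≤ dist y u} with hG_def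
  have hG : IsClosed G := by
    refine isClosed_sphere.inter ?_
    simp only [ofPred_forall]
    exact isClosed_biInter fun u _ => isClosed_le continuous_const (by fun_prop)
  have hhalf := half_sphere_le hd0 hε (by linarith) hcap
  have hGS : G ⊆ sphere 0 1 := inter_subset_left
  have hk2 : 0 < 1 - ε ^ 2 / 2 := by nlinarith
  have hk : √(1 - ε ^ 2 / 2) ≤ 1 - ε ^ 2 / 4 := by
    rw [Real.sqrt_le_left (by nlinarith)]
    nlinarith [sq_nonneg (ε ^ 2)]
  have hdev := hP.mul_sphere_inter_le_deviation hd hG hGS (Real.sqrt_pos.2 hk2)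
    (hk.trans (by nlinarith)) (by
      intro y hy u hu
      rw [Real.sq_sqrt hk2.le]
      have h1 := hy.2 u hu
      rw [dist_eq_norm, ← sq_le_sq₀ hε.le (norm_nonneg _), norm_sub_sq_real,
        mem_sphere_zero_iff_norm.1 hy.1, hP.norm_eq_one u hu] at h1
      linarith)
  have hσG : (sphereMeasure E).real G = μHE[finrank ℝ E - 1].real G := by
    rw [measureReal_def, measureReal_def, sphereMeasure_eq hGS hG.measurableSet]
  have hσS : (sphereMeasure E).real univ = μHE[finrank ℝ E - 1].real (sphere (0 : E) 1) := by
    rw [measureReal_def, measureReal_def, ← sphereMeasure_inter_sphere univ, univ_inter,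
      sphereMeasure_eq subset_rfl isClosed_sphere.measurableSet]
  rw [← hG_def, hσG, hσS] at hhalf
  refine le_trans ?_ hdev
  have hS0 : 0 ≤ μHE[finrank ℝ E - 1].real (sphere (0 : E) 1) := measureReal_nonneg
  -- The constant is `1 - k ≥ ε ^ 2 / 4` times one half of the sphere, and `ε ^ 2 / 8 = 1 / (512 * q
  -- ^ 2)`.
  calc 1 / 512 * (μHE[finrank ℝ E - 1].real (sphere (0 : E) 1) /
        (N : ℝ) ^ (2 / ((finrank ℝ E : ℝ) - 1)))
      = ε ^ 2 / 4 * (μHE[finrank ℝ E - 1].real (sphere (0 : E) 1) / 2) := by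
        rw [hq2, hε_def]
        field_simp
        ring
    _ ≤ (1 - √(1 - ε ^ 2 / 2)) * μHE[finrank ℝ E - 1].real G := by
        exact mul_le_mul (by linarith) hhalf (by linarith) (by nlinarith)

end

/-! ### Dimension of convex sets and exposed faces. -/

section

theorem Convex.euclideanHausdorffMeasure_eq_zero {E : Type*} [NormedAddCommGroup E]
    [InnerProductSpace ℝ E] [MeasurableSpace E] [BorelSpace E] [FiniteDimensional ℝ E]
    {C : Set E} (hC : Convex ℝ C) {d : ℕ} (hd : C.Nonempty → finrank ℝ (vectorSpan ℝ C) < d) :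
    μHE[d] C = 0 := by
  rcases C.eq_empty_or_nonempty with rfl | hne
  · simp
  have h1 : μH[(d : ℝ)] C = 0 := by
    have := hausdorffMeasure_of_dimH_lt (s := C) (d := (d : ℝ≥0)) (by
      rw [Real.Convex.dimH_eq_finrank_vectorSpan hC hne]
      exact_mod_cast hd hne)
    simpa using this
  rw [euclideanHausdorffMeasure_def, Measure.smul_apply, h1, smul_zero]

section

variable {E : Type*} [NormedAddCommGroup E] [NormedSpace ℝ E]

theorem vectorSpan_convexHull (T : Set E) : vectorSpan ℝ (convexHull ℝ T) = vectorSpan ℝ T := by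
  rw [← direction_affineSpan, affineSpan_convexHull, direction_affineSpan]

theorem vectorSpan_le_ker {F : Set E} {l : StrongDual ℝ E} {a : ℝ} (h : ∀ x ∈ F, l x = a) :
    vectorSpan ℝ F ≤ LinearMap.ker (l : E →ₗ[ℝ] ℝ) := by
  rw [vectorSpan_def, Submodule.span_le]
  rintro _ ⟨x, hx, y, hy, rfl⟩
  simp [h x hx, h y hy]

/-- A functional that is constant on a subset of full dimension is constant. -/
theorem apply_eq_of_finrank_le [FiniteDimensional ℝ E] {C F : Set E} (hCF : C ⊆ F)
    (hdim : finrank ℝ (vectorSpan ℝ F) ≤ finrank ℝ (vectorSpan ℝ C)) {l : StrongDual ℝ E} {a : ℝ}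
    (hl : ∀ x ∈ C, l x = a) (hC : C.Nonempty) : ∀ x ∈ F, l x = a := by
  obtain ⟨c, hc⟩ := hC
  intro x hx
  have hle : vectorSpan ℝ C ≤ vectorSpan ℝ F := vectorSpan_mono ℝ hCF
  have heq := Submodule.eq_of_le_of_finrank_le hle hdim
  have h1 : x -ᵥ c ∈ vectorSpan ℝ F := vsub_mem_vectorSpan ℝ hx (hCF hc)
  rw [← heq] at h1
  have h2 := vectorSpan_le_ker hl h1
  have h3 : l (x - c) = 0 := h2
  rw [map_sub, hl c hc, sub_eq_zero] at h3
  exact h3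

/-- This is Krein–Milman for the face: its extreme points are those of the polytope lying in it, and
being finite in number they have a closed hull. -/
theorem IsExposed.eq_convexHull_extremePoints {S F : Set E} (hS : S.Finite)
    (hF : IsExposed ℝ (convexHull ℝ S) F) :
    F = convexHull ℝ ((convexHull ℝ S).extremePoints ℝ ∩ F) := by
  have hPc := hS.isCompact_convexHull ℝ
  have hFc := hF.isCompact hPc
  have hFconv := hF.convex (convex_convexHull ℝ S)
  have hext : F.extremePoints ℝ = (convexHull ℝ S).extremePoints ℝ ∩ F := by
    rw [hF.isExtreme.extremePoints_eq, inter_comm]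
  have hfin : ((convexHull ℝ S).extremePoints ℝ ∩ F).Finite :=
    (hS.subset extremePoints_convexHull_subset).subset inter_subset_left
  conv_lhs => rw [← closure_convexHull_extremePoints hFc hFconv, hext]
  exact (hfin.isCompact_convexHull ℝ).isClosed.closure_eq

theorem finrank_vectorSpan_add_one_le_ncard {T : Set E} (hT : T.Finite) (hne : T.Nonempty) :
    finrank ℝ (vectorSpan ℝ T) + 1 ≤ T.ncard := by
  classical
  lift T to Finset E using hT
  rw [ncard_coe_finset]
  obtain ⟨m, hm⟩ : ∃ m, T.card = m + 1 :=
    ⟨T.card - 1, by have := Finset.card_pos.2 (Finset.coe_nonempty.1 hne); omega⟩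
  have := finrank_vectorSpan_image_finset_le ℝ (id : E → E) T hm
  rw [Finset.image_id] at this
  omega

theorem finrank_vectorSpan_lt [FiniteDimensional ℝ E] {F : Set E} {l : StrongDual ℝ E} (hl : l ≠ 0)
    {a : ℝ} (h : ∀ x ∈ F, l x = a) : finrank ℝ (vectorSpan ℝ F) < finrank ℝ E := by
  refine Submodule.finrank_lt fun htop => hl ?_
  have h1 := vectorSpan_le_ker h
  rw [htop, top_le_iff, LinearMap.ker_eq_top] at h1
  ext x
  exact LinearMap.congr_fun h1 x

end

/-! ### Facets of simple polytopes. -/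

section Polytope

variable {n : ℕ} {P : Set (EuclideanSpace ℝ (Fin n))}

theorem IsPolytope.isCompact (hP : IsPolytope P) : IsCompact P := by
  obtain ⟨S, hS, -, rfl⟩ := hP
  exact hS.isCompact_convexHull ℝ

theorem IsPolytope.convex (hP : IsPolytope P) : Convex ℝ P := by
  obtain ⟨S, hS, -, rfl⟩ := hP
  exact convex_convexHull ℝ S

theorem IsPolytope.vertices_finite (hP : IsPolytope P) : (vertices P).Finite := by
  obtain ⟨S, hS, -, rfl⟩ := hP
  exact hS.subset extremePoints_convexHull_subset

theorem IsPolytope.vertices_nonempty (hP : IsPolytope P) : (vertices P).Nonempty := by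
  refine hP.isCompact.extremePoints_nonempty ?_
  obtain ⟨S, hS, hne, rfl⟩ := hP
  exact hne.convexHull

theorem IsPolytope.eq_convexHull_of_isExposed (hP : IsPolytope P)
    {F : Set (EuclideanSpace ℝ (Fin n))} (hF : IsExposed ℝ P F) :
    F = convexHull ℝ (vertices P ∩ F) := by
  obtain ⟨S, hS, -, rfl⟩ := hP
  exact hF.eq_convexHull_extremePoints hS

theorem IsPolytope.finite_facets (hP : IsPolytope P) : {F | IsFacet P F}.Finite := by
  refine (hP.vertices_finite.powerset.image (convexHull ℝ)).subset fun F hF => ?_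
  exact ⟨vertices P ∩ F, inter_subset_left, (hP.eq_convexHull_of_isExposed hF.2.1).symm⟩

/-- A facet is the hull of its vertices, and spanning dimension `n - 1` takes at least `n` points.
-/
theorem IsPolytope.le_ncard_vertices_inter (hP : IsPolytope P)
    {F : Set (EuclideanSpace ℝ (Fin n))} (hF : IsFacet P F) : n ≤ (vertices P ∩ F).ncard := by
  have h1 := hP.eq_convexHull_of_isExposed hF.2.1
  have hne : (vertices P ∩ F).Nonempty := by
    rw [← convexHull_nonempty_iff (𝕜 := ℝ), ← h1]
    exact hF.1
  have h2 := finrank_vectorSpan_add_one_le_ncard (hP.vertices_finite.subset inter_subset_left) hne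
  rw [← vectorSpan_convexHull, ← h1, hF.2.2] at h2
  exact h2

/-- A simple polytope has at most as many facets as vertices. -/
theorem IsSimplePolytope.ncard_facets_le (hP : IsSimplePolytope P) (hn : 0 < n) :
    {F | IsFacet P F}.ncard ≤ (vertices P).ncard := by
  classical
  have hV := hP.1.vertices_finite
  have hF := hP.1.finite_facets
  -- Double counting of incidences: at least `n` vertices per facet, exactly `n` facets per vertex.
  have h := Finset.card_mul_le_card_mul (s := hF.toFinset) (t := hV.toFinset)
    (r := fun F v => v ∈ F) (m := n) (n := n) ?_ ?_
  · rw [ncard_eq_toFinset_card _ hF, ncard_eq_toFinset_card _ hV]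
    exact Nat.le_of_mul_le_mul_right h hn
  · intro F hFm
    have h1 := hP.1.le_ncard_vertices_inter ((hF.mem_toFinset).1 hFm)
    rw [← ncard_coe_finset]
    convert h1 using 2
    ext v
    simp [Finset.bipartiteAbove]
  · intro v hv
    have h1 := hP.2 v ((hV.mem_toFinset).1 hv)
    rw [← ncard_coe_finset]
    have h2 : ((Finset.bipartiteBelow (fun F v => v ∈ F) hF.toFinset v : Finset _) :
        Set (Set (EuclideanSpace ℝ (Fin n)))) = {F | IsFacet P F ∧ v ∈ F} := by
      ext F
      simp [Finset.bipartiteBelow]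
    rw [h2, ncard_def, h1]
    simp

/-- A facet spanning the same directions as the polytope is the whole polytope. -/
theorem IsFacet.eq_of_finrank_le {F : Set (EuclideanSpace ℝ (Fin n))} (hF : IsFacet P F)
    (h : finrank ℝ (vectorSpan ℝ P) + 1 ≤ n) : F = P := by
  obtain ⟨l, hl⟩ := hF.2.1 hF.1
  obtain ⟨x, hx⟩ := hF.1
  have hsub := hF.2.1.subset
  have hlF : ∀ y ∈ F, l y = l x := by
    intro y hy
    rw [hl] at hx hy
    exact le_antisymm (hx.2 y hy.1) (hy.2 x hx.1)
  have hdim := hF.2.2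
  have hlP := apply_eq_of_finrank_le hsub (by omega) hlF ⟨x, hx⟩
  refine subset_antisymm hsub fun y hy => ?_
  rw [hl]
  exact ⟨hy, fun z hz => by rw [hlP y hy, hlP z hz]⟩

/-- In a lower-dimensional polytope every facet is the whole polytope, so at most one facet passes
through a vertex, whereas `n ≥ 2` are required. -/
theorem IsSimplePolytope.interior_nonempty (hP : IsSimplePolytope P) (hn : 2 ≤ n) :
    (interior P).Nonempty := by
  rw [hP.1.convex.interior_nonempty_iff_affineSpan_eq_top]
  obtain ⟨v, hv⟩ := hP.1.vertices_nonempty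
  have hvP : v ∈ P := extremePoints_subset hv
  rw [AffineSubspace.affineSpan_eq_top_iff_vectorSpan_eq_top_of_nonempty _ _ _ ⟨v, hvP⟩]
  by_contra htop
  have hlt := Submodule.finrank_lt htop
  rw [finrank_euclideanSpace_fin] at hlt
  have hsub : {F | IsFacet P F ∧ v ∈ F} ⊆ {P} := fun F hF => hF.1.eq_of_finrank_le hlt
  have h1 := encard_le_encard hsub
  rw [hP.2 v hv, encard_singleton] at h1
  have : n ≤ 1 := by exact_mod_cast h1
  omega

/-- A facet of a polytope with interior points is cut out by a unit normal. -/
theorem IsFacet.exists_normal {F : Set (EuclideanSpace ℝ (Fin n))} (hF : IsFacet P F)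
    (hint : (interior P).Nonempty) :
    ∃ u : EuclideanSpace ℝ (Fin n), ‖u‖ = 1 ∧ ∃ a : ℝ, (∀ x ∈ P, ⟪x, u⟫ ≤ a) ∧
      F = {x ∈ P | ⟪x, u⟫ = a} := by
  obtain ⟨l, hl⟩ := hF.2.1 hF.1
  obtain ⟨x₀, hx₀⟩ := hF.1
  have hl0 : l ≠ 0 := by
    rintro rfl
    have hFP : F = P := by rw [hl]; simp
    have h1 := hF.2.2
    have h2 : vectorSpan ℝ P = ⊤ := by
      rw [← direction_affineSpan, affineSpan_eq_top_of_nonempty_interior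
        (hint.mono (interior_mono (subset_convexHull ℝ P))), AffineSubspace.direction_top]
    rw [hFP, h2, finrank_top, finrank_euclideanSpace_fin] at h1
    omega
  set w := (InnerProductSpace.toDual ℝ (EuclideanSpace ℝ (Fin n))).symm l with hw
  have hw0 : w ≠ 0 := by rw [hw]; simpa using hl0
  have hwn : 0 < ‖w‖ := norm_pos_iff.2 hw0
  have hlw : ∀ x, ⟪x, ‖w‖⁻¹ • w⟫ = ‖w‖⁻¹ * l x := by
    intro x
    rw [real_inner_smul_right, real_inner_comm, hw, InnerProductSpace.toDual_symm_apply]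
  rw [hl] at hx₀
  refine ⟨‖w‖⁻¹ • w, by rw [norm_smul, norm_inv, norm_norm, inv_mul_cancel₀ hwn.ne'],
    ‖w‖⁻¹ * l x₀, fun x hx => ?_, ?_⟩
  · rw [hlw]
    exact mul_le_mul_of_nonneg_left (hx₀.2 x hx) (by positivity)
  · rw [hl]
    ext x
    simp only [mem_ofPred_eq, hlw]
    refine and_congr_right fun hx => ?_
    rw [mul_right_inj' (by positivity)]
    exact ⟨fun h => le_antisymm (hx₀.2 x hx) (h x₀ hx₀.1), fun h y hy => h ▸ hx₀.2 y hy⟩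

/-- A boundary point on no facet lies on an exposed face of dimension below `n - 1`. Each such face
is the hull of a set of vertices, so there are finitely many and they are null together. -/
theorem IsSimplePolytope.exists_hasFaces (hP : IsSimplePolytope P) (hn : 2 ≤ n) :
    ∃ (U : Finset (EuclideanSpace ℝ (Fin n))) (h : EuclideanSpace ℝ (Fin n) → ℝ),
      HasFaces P U h ∧ U.card ≤ (vertices P).ncard := by
  classical
  have hint := hP.interior_nonempty hn
  have hF := hP.1.finite_facets
  have hPc := hP.1.isCompact
  have hfin : finrank ℝ (EuclideanSpace ℝ (Fin n)) = n := finrank_euclideanSpace_fin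
  let nu : Set (EuclideanSpace ℝ (Fin n)) → EuclideanSpace ℝ (Fin n) := fun F =>
    if hF : IsFacet P F then (hF.exists_normal hint).choose else 0
  -- The offset must depend on the normal alone, so the support function of `P` is taken; it takes
  -- the right value on each facet normal.
  let h : EuclideanSpace ℝ (Fin n) → ℝ := fun u => sSup ((fun x => ⟪x, u⟫) '' P)
  have hnu : ∀ F, IsFacet P F → ‖nu F‖ = 1 ∧ (∀ x ∈ P, ⟪x, nu F⟫ ≤ h (nu F)) ∧
      F = {x ∈ P | ⟪x, nu F⟫ = h (nu F)} := by
    intro F hF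
    have hnuF : nu F = (hF.exists_normal hint).choose := dif_pos hF
    obtain ⟨h1, a, h2, h3⟩ := (hF.exists_normal hint).choose_spec
    rw [← hnuF] at h1 h2 h3
    have ha : h (nu F) = a := by
      obtain ⟨x, hx⟩ := hF.1
      rw [h3] at hx
      refine IsGreatest.csSup_eq ⟨⟨x, hx.1, hx.2⟩, ?_⟩
      rintro _ ⟨y, hy, rfl⟩
      exact h2 y hy
    rw [ha]
    exact ⟨h1, h2, h3⟩
  have hmemU : ∀ u, u ∈ hF.toFinset.image nu ↔ ∃ F, IsFacet P F ∧ nu F = u := by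
    intro u
    simp
  refine ⟨hF.toFinset.image nu, h, ⟨hPc, ?_, ?_, ?_, ?_⟩, ?_⟩
  · intro u hu
    obtain ⟨F, hFf, rfl⟩ := (hmemU u).1 hu
    exact (hnu F hFf).1
  · intro u hu
    obtain ⟨F, hFf, rfl⟩ := (hmemU u).1 hu
    exact (hnu F hFf).2.1
  · refine measure_mono_null (t := ⋃ T ∈ {T | T ⊆ vertices P ∧
      finrank ℝ (vectorSpan ℝ T) < n - 1}, convexHull ℝ T) ?_ ?_
    · rintro x ⟨hx, hxU⟩
      rw [hPc.isClosed.frontier_eq] at hx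
      -- A supporting hyperplane at `x` exposes a face containing `x`.
      obtain ⟨l, a, hl0, hla, hlx⟩ := geometric_hahn_banach_of_nonempty_interior hP.1.convex
        (convex_singleton x) (disjoint_singleton_right.2 hx.2) hint (singleton_nonempty x)
      have hla' : l x = a := le_antisymm (hla x hx.1) (hlx x rfl)
      let F : Set (EuclideanSpace ℝ (Fin n)) := {y ∈ P | ∀ z ∈ P, l z ≤ l y}
      have hFe : IsExposed ℝ P F := fun _ => ⟨l, rfl⟩
      have hxF : x ∈ F := ⟨hx.1, fun z hz => hla' ▸ hla z hz⟩
      have hFa : ∀ y ∈ F, l y = a := fun y hy => le_antisymm (hla y hy.1) (hla' ▸ hy.2 x hx.1)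
      have hlt := finrank_vectorSpan_lt hl0 hFa
      rw [hfin] at hlt
      have hFhull := hP.1.eq_convexHull_of_isExposed hFe
      have hne : finrank ℝ (vectorSpan ℝ F) + 1 ≠ n := by
        intro hdim
        have hfacet : IsFacet P F := ⟨⟨x, hxF⟩, hFe, hdim⟩
        refine hxU (mem_iUnion₂.2 ⟨nu F, (hmemU _).2 ⟨F, hfacet, rfl⟩, ?_⟩)
        rw [← (hnu F hfacet).2.2]
        exact hxF
      refine mem_iUnion₂.2 ⟨vertices P ∩ F, ⟨inter_subset_left, ?_⟩, ?_⟩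
      · rw [← vectorSpan_convexHull, ← hFhull]
        omega
      · rw [← hFhull]
        exact hxF
    · have hTfin : {T | T ⊆ vertices P ∧ finrank ℝ (vectorSpan ℝ T) < n - 1}.Finite :=
        hP.1.vertices_finite.powerset.subset fun T hT => hT.1
      rw [measure_biUnion_null_iff hTfin.countable]
      intro T hT
      refine (convex_convexHull ℝ T).euclideanHausdorffMeasure_eq_zero fun _ => ?_
      rw [vectorSpan_convexHull, hfin]
      exact hT.2
  · intro u hu v hv huv
    obtain ⟨F, hFf, rfl⟩ := (hmemU u).1 hu
    obtain ⟨F', hFf', rfl⟩ := (hmemU v).1 hv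
    rw [← (hnu F hFf).2.2, ← (hnu F' hFf').2.2]
    have hc := hP.1.convex
    refine ((hFf.2.1.convex hc).inter (hFf'.2.1.convex hc)).euclideanHausdorffMeasure_eq_zero
      fun hne => ?_
    rw [hfin]
    by_contra! hge
    -- If two facets share a set of full facet dimension, the functional exposing one is constant on
    -- the other, so each contains the other.
    have key : ∀ A B, IsFacet P A → IsFacet P B → (A ∩ B).Nonempty →
        n - 1 ≤ finrank ℝ (vectorSpan ℝ (A ∩ B : Set (EuclideanSpace ℝ (Fin n)))) → A ⊆ B := by
      intro A B hA hB hne hge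
      obtain ⟨x, hx⟩ := hne
      obtain ⟨l, hl⟩ := hB.2.1 hB.1
      have hdim := hA.2.2
      have hlx := hx.2
      rw [hl] at hlx
      have hconst : ∀ y ∈ A ∩ B, l y = l x := by
        intro y hy
        have hly := hy.2
        rw [hl] at hly
        exact le_antisymm (hlx.2 y hly.1) (hly.2 x hlx.1)
      have := apply_eq_of_finrank_le inter_subset_left (by omega) hconst ⟨x, hx⟩
      intro y hy
      rw [hl]
      exact ⟨hA.2.1.subset hy, fun z hz => this y hy ▸ hlx.2 z hz⟩
    refine huv (congrArg nu (subset_antisymm (key F F' hFf hFf' hne hge)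
      (key F' F hFf' hFf ?_ ?_)))
    · rwa [inter_comm]
    · rwa [inter_comm]
  · refine Finset.card_image_le.trans ?_
    rw [← ncard_eq_toFinset_card _ hF]
    exact hP.ncard_facets_le (by omega)

end Polytope

end

/-! ### The lower bound for simple polytopes. -/

section

theorem mainTheorem3 :
    ∃ c : ℝ, 0 < c ∧ ∃ N₀ : ℕ, ∀ n : ℕ, 2 ≤ n → ∀ N : ℕ, N₀ ≤ N →
      ∀ P : Set (EuclideanSpace ℝ (Fin n)), IsSimplePolytope P → (vertices P).encard ≤ N →
        surfaceDeviation (unitBall n) P ≥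
          c * (surfaceArea (unitBall n) / (N : ℝ) ^ (2 / ((n : ℝ) - 1))) := by
  refine ⟨1 / 512, by norm_num, 1, fun n hn N hN P hP hV => ?_⟩
  obtain ⟨U, h, hU, hcard⟩ := hP.exists_hasFaces hn
  have hVN : (vertices P).ncard ≤ N := by
    rw [← hP.1.vertices_finite.cast_ncard_eq] at hV
    exact_mod_cast hV
  have hfin : finrank ℝ (EuclideanSpace ℝ (Fin n)) = n := finrank_euclideanSpace_fin
  have := hU.deviation_ge (by rw [hfin]; exact hn) hN (hcard.trans hVN)
  rw [hfin] at this
  unfold surfaceDeviation surfaceArea unitBall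
  rwa [frontier_closedBall _ one_ne_zero]

end
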